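/- Let $\Omega=(0,1)$, $\gamma=\tfrac15$, $t_F=3$, fix $x_0$ with $\gamma<x_0<1-\gamma$, and let $u_0(x)=1$ for $x<x_0-\gamma$, $u_0(x)=\tfrac12-\tfrac12\sin\!\big(\tfrac{\pi}{2\gamma}(x-x_0)\big)$ for $|x-x_0|\le\gamma$, $u_0(x)=0$ for $x>x_0+\gamma$. Put $x_S(t)=x_0+t/2$, let $I(t)$ be the open interval between the infimum and the supremum of $\{\xi: \xi+t\,u_0(\xi)=x_S(t)\}$, let $X(t,\xi)=x_S(t)$ if $\xi\in I(t)$ and $X(t,\xi)=\xi+t\,u_0(\xi)$ otherwise, and let $u(\cdot,t)=u_0\circ X(t,\cdot)^{-1}$, with the generalized inverse $X(t,\cdot)^{-1}(x)=\inf\{\xi: x\le X(t,\xi)\}$. **Networks.** Let $\sigma(x)=\max\{0,x\}$ and let $\varsigma=\sigma'$ be the threshold function, with $\varsigma(0)=0$. A *reduced activation* on $\mathbb R^m$ is a map $\xi(y)=U^{T}\big(\rho\odot(Vy)\big)$, where $U,V\in\mathbb R^{N\times m}$ ($N$ arbitrary) have orthonormal columns and $\rho\in\{\sigma,\varsigma\}^N$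 acts entrywise. A *reduced deep network* (RDN) with dimensions $\mathbf M=(M_1,\dots,M_{L+1})$, $M_1=M_{L+1}=1$, and reduced activations $\Xi=(\xi_1,\dots,\xi_{L-1})$ is a function $B_L\circ\xi_{L-1}\circ B_{L-1}\circ\dots\circ\xi_1\circ B_1$ with affine maps $B_\ell(y)=\Gamma_\ell y+c_\ell$, $\Gamma_\ell\in\mathbb R^{M_{\ell+1}\times M_\ell}$, $c_\ell\in\mathbb R^{M_{\ell+1}}$. Its number of degrees of freedom is $\sum_{\ell=1}^{L}M_{\ell+1}(M_\ell+1)$, with no reduction for shared weights. Let $\mathcal N_\sharp$ be the set of RDNs that are nondecreasing on $[0,1]$. For $g\in\mathcal N_\sharp$ nonconstant on $[0,1]$ and $n\in\mathbb N$ let $g^{\flat,n}(x)$ be the midpoint of the interval left after $n$ bisection steps for the equation $g(y)=x$ started from $(0,1)$: the left half is kept if $\varsigma(g(m)-x)=1$ at the midpoint $m$, the right half otherwise. Let $\mathcal N_\flat$ be the set of all these $g^{\flat,n}$, and let $\mathcal N_{\mathrm{mats}}$ be the set of all $v\circ T_{k}\circ\dots\circ T_1$ with $k\ge0$, $v$ an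 RDN and $T_i\in\mathcal N_\sharp\cup\mathcal N_\flat$. **Theorem.** The function $u$ is an entropy solution on $0<t<3$ of the Burgers' equation $u_t+(\tfrac12u^2)_x=0$ with $u(\cdot,0)=u_0$: it is bounded and measurable, a weak solution on $\mathbb R\times(0,3)$ with initial values $u_0$, continuous in time on $[0,3]$ with values in $L^1_{\mathrm{loc}}(\mathbb R)$, satisfies $u(x+z,t)-u(x,t)\le K(1+\tfrac1t)z$ for all $0<t\le 3$, $x\in\mathbb R$, $z>0$ and some constant $K\ge0$, and has the boundary values $\lim_{x\downarrow0}u(x,t)=u_0(0)$ for all $t\in[0,3]$. Moreover there is a constant $C$ such that for every $\varepsilon\in(0,1)$ there are dimensions $\mathbf M$ and reduced activations $\Xi$, both independent of $t$, and reduced weights $\Gamma(t)$, such that the corresponding RDNs $u^{\mathrm{rd}}(\cdot;t)$ satisfy 1. $\|u(\cdot,t)-u^{\mathrm{rd}}(\cdot;t)\|_{L^2(0,1)}<\varepsilon$ for every $t\in[0,3]$; 2. the total number of degrees of freedom is at most $C(1+|\log\varepsilon|)$; 3. the reduced deep network solution manifold $\{u^{\mathrm{rd}}(\cdot;t):t\in[0,3]\}$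 is contained in $\mathcal N_{\mathrm{mats}}$; 4. more precisely, there are an RDN $v$ and $n\le C(1+|\log\varepsilon|)$, both independent of $t$, such that for every $t\in[0,3]$ $$u^{\mathrm{rd}}(\cdot;t)=v\circ T_2\circ(T_{12}\circ T_{11})^{\flat,n},$$ where, for some real weights depending on $t$, $T_{11}(x)=x+w_{111}\varsigma(x+w_{112})$ and $T_2(x)=x+w_{21}\varsigma(x+w_{22})$ are threshold layers, $T_{12}(x)=x+w_{12}v(x)$, the functions $T_{11}$, $T_2$ and $T_{12}\circ T_{11}$ belong to $\mathcal N_\sharp$, and $T_{12}\circ T_{11}$ is not constant on $[0,1]$. -/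

import Mathlib

open Set Filter Topology MeasureTheory
open scoped ContDiff Matrix

namespace DeepReduction

/-! ### Reduced deep networks -/

/-- The admissible activation functions: the rectified linear unit and the threshold function. -/
inductive Activation where
  | relu
  | threshold

/-- The rectified linear unit `σ(x) = max 0 x`. -/
noncomputable def relu (x : ℝ) : ℝ := max 0 x

/-- The threshold function `ς = σ'`, normalised by `ς(0) = 0`. -/
noncomputable def threshold (x : ℝ) : ℝ := if 0 < x then 1 else 0

/-- The real function that an activation stands for. -/
noncomputable def Activation.toFun : Activation → ℝ → ℝ
  | .relu => DeepReduction.relu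
  | .threshold => DeepReduction.threshold

/-- The data of a reduced activation `ξ : ℝᵐ → ℝᵐ`, `ξ(y) = Uᵀ (ρ ⊙ (V y))`: a full width `N`,
one activation for each of the `N` neurons, and two `N × m` matrices with orthonormal columns. -/
structure ReducedActivation (m : ℕ) where
  width : ℕ
  ρ : Fin width → Activation
  U : Matrix (Fin width) (Fin m) ℝ
  V : Matrix (Fin width) (Fin m) ℝ
  U_orthonormal : Uᵀ * U = 1
  V_orthonormal : Vᵀ * V = 1

/-- `ξ(y) = Uᵀ (ρ ⊙ (V y))`. -/
noncomputable def ReducedActivation.apply {m : ℕ} (ξ : ReducedActivation m) (y : Fin m → ℝ) :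
    Fin m → ℝ :=
  ξ.Uᵀ *ᵥ fun i => (ξ.ρ i).toFun ((ξ.V *ᵥ y) i)

/-- The reduced weights of one map `B : ℝᵐ → ℝⁿ`. The bias is the column of weights that belongs
to the dummy input `1`. -/
structure LayerWeights (m n : ℕ) where
  weight : Matrix (Fin n) (Fin m) ℝ
  bias : Fin n → ℝ

/-- `B(y) = Γ y + c`. -/
noncomputable def LayerWeights.apply {m n : ℕ} (B : LayerWeights m n) (y : Fin m → ℝ) :
    Fin n → ℝ :=
  B.weight *ᵥ y + B.bias

/-- The part of a reduced deep network that is not a weight, namely its dimensions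
`(M₁, …, M_{L+1})` (here `M₁ = m` and `M_{L+1} = k`) and its reduced activations
`(ξ₁, …, ξ_{L-1})`. -/
inductive Architecture : ℕ → ℕ → Type
  /-- A single map `B_L : ℝᵐ → ℝᵏ`. -/
  | output (m k : ℕ) : Architecture m k
  /-- A map `B : ℝᵐ → ℝⁿ`, followed by the reduced activation `ξ`, followed by `rest`. -/
  | hidden (m : ℕ) {n k : ℕ} (ξ : ReducedActivation n) (rest : Architecture n k) :
      Architecture m k

/-- The reduced weights `Γ = (Γ₁, …, Γ_L)` (with biases) that fit a given architecture. -/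
def Architecture.Weights : {m k : ℕ} → Architecture m k → Type
  | _, _, .output m k => LayerWeights m k
  | _, _, .hidden m (n := n) _ rest => LayerWeights m n × rest.Weights

/-- `B_L ∘ ξ_{L-1} ∘ B_{L-1} ∘ ⋯ ∘ ξ₁ ∘ B₁`. -/
noncomputable def Architecture.eval :
    {m k : ℕ} → (A : Architecture m k) → A.Weights → (Fin m → ℝ) → (Fin k → ℝ)
  | _, _, .output _ _, Γ, y => LayerWeights.apply Γ y
  | _, _, .hidden _ ξ rest, Γ, y => rest.eval Γ.2 (ξ.apply (Γ.1.apply y))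

/-- The total number of degrees of freedom: the number of entries of all the reduced weights and
biases. Nothing is subtracted for weights that are shared between layers. -/
def Architecture.dof : {m k : ℕ} → Architecture m k → ℕ
  | _, _, .output m k => k * (m + 1)
  | _, _, .hidden m (n := n) _ rest => n * (m + 1) + rest.dof

/-- The reduced deep network with one input and one output, as a function on the real line. -/
noncomputable def Architecture.realize (A : Architecture 1 1) (Γ : A.Weights) (x : ℝ) : ℝ :=
  A.eval Γ (fun _ => x) 0

/-- The class of reduced deep networks. -/
def rdn : Set (ℝ → ℝ) := {f | ∃ (A : Architecture 1 1) (Γ : A.Weights), f = A.realize Γ}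

/-! ### The MATS architecture -/

/-- The reduced deep networks that are nondecreasing on the spatial domain `[0,1]`. -/
def rdnSharp : Set (ℝ → ℝ) := {f | f ∈ rdn ∧ MonotoneOn f (Icc 0 1)}

/-- One bisection step for `f(y) = x` on an interval `(a,b)`. The left half is kept if
`ς(f((a+b)/2) - x) = 1`, the right half otherwise. -/
noncomputable def bisectStep (f : ℝ → ℝ) (x : ℝ) (p : ℝ × ℝ) : ℝ × ℝ :=
  if threshold (f ((p.1 + p.2) / 2) - x) = 1 then (p.1, (p.1 + p.2) / 2)
  else ((p.1 + p.2) / 2, p.2)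

/-- The approximate inverse `f^♭` with `n` inversion layers: the midpoint of the interval that is
left of `(0,1)` after `n` bisection steps. -/
noncomputable def approxInverse (f : ℝ → ℝ) (n : ℕ) (x : ℝ) : ℝ :=
  (((bisectStep f x)^[n] (0, 1)).1 + ((bisectStep f x)^[n] (0, 1)).2) / 2

/-- The approximate inverses of the nonconstant nondecreasing reduced deep networks. -/
def rdnFlat : Set (ℝ → ℝ) :=
  {h | ∃ g ∈ rdnSharp, (∃ y ∈ Icc (0 : ℝ) 1, ∃ z ∈ Icc (0 : ℝ) 1, g y ≠ g z) ∧
    ∃ n : ℕ, h = approxInverse g n}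

/-- The functions `v ∘ T_{L-1} ∘ ⋯ ∘ T₁`, where `v` is a reduced deep network and every `Tᵢ` is a
nondecreasing reduced deep network or an approximate inverse of one. The list is
`[T_{L-1}, …, T₁]`. -/
def rdnMats : Set (ℝ → ℝ) :=
  {f | ∃ v ∈ rdn, ∃ Ts : List (ℝ → ℝ), (∀ T ∈ Ts, T ∈ rdnSharp ∪ rdnFlat) ∧
    f = v ∘ Ts.foldr (fun T S => T ∘ S) id}

/-- The threshold layer `x ↦ x + w ς(x + b)`. -/
noncomputable def thresholdLayer (w b x : ℝ) : ℝ := x + w * threshold (x + b)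

/-- `A` with the weights `Γ(t)`, `t ∈ [0,T]`, is a reduced deep network solution for the functions
`u(t) ∈ L²(0,1)` with error threshold `ε`. Dimensions and reduced activations (that is, `A`) do
not depend on `t`. -/
def IsReducedSolution (u : ℝ → ℝ → ℝ) (T ε : ℝ) (A : Architecture 1 1) (Γ : ℝ → A.Weights) :
    Prop :=
  ∀ t ∈ Icc 0 T,
    eLpNorm (fun x => u t x - A.realize (Γ t) x) 2 (volume.restrict (Ioo 0 1)) < ENNReal.ofReal ε

/-- The reduced deep network solution manifold `{A.realize (Γ t) : t ∈ [0,T]}`. -/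
def reducedManifold (T : ℝ) (A : Architecture 1 1) (Γ : ℝ → A.Weights) : Set (ℝ → ℝ) :=
  (fun t => A.realize (Γ t)) '' Icc 0 T

/-- `f = v ∘ T₂ ∘ (T₁₂ ∘ T₁₁)^♭` with threshold layers `T₂`, `T₁₁`, with `T₁₂(x) = x + w₁₂ v(x)`
and with the bisection inverse with `n` layers of the nonconstant nondecreasing `T₁₂ ∘ T₁₁`. -/
def IsSingularMats (v : ℝ → ℝ) (n : ℕ) (f : ℝ → ℝ) : Prop :=
  ∃ w₁₁₁ w₁₁₂ w₁₂ w₂₁ w₂₂ : ℝ,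
    thresholdLayer w₁₁₁ w₁₁₂ ∈ rdnSharp ∧
    thresholdLayer w₂₁ w₂₂ ∈ rdnSharp ∧
    (fun x => x + w₁₂ * v x) ∘ thresholdLayer w₁₁₁ w₁₁₂ ∈ rdnSharp ∧
    (∃ y ∈ Icc (0 : ℝ) 1, ∃ z ∈ Icc (0 : ℝ) 1,
      ((fun x => x + w₁₂ * v x) ∘ thresholdLayer w₁₁₁ w₁₁₂) y ≠
        ((fun x => x + w₁₂ * v x) ∘ thresholdLayer w₁₁₁ w₁₁₂) z) ∧
    f = v ∘ thresholdLayer w₂₁ w₂₂ ∘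
      approxInverse ((fun x => x + w₁₂ * v x) ∘ thresholdLayer w₁₁₁ w₁₁₂) n

/-! ### The Burgers equation -/

/-- `u` (first argument time, second argument space) is the entropy solution of
`u_t + (u²/2)_x = 0` for `0 < t < T` with initial values `g`: a bounded measurable weak solution,
continuous in time with values in `L¹_loc`, that obeys Oleinik's one-sided inequality. It is
defined on the whole line, and its trace at the left end of the spatial domain `(0,1)` takes the
boundary value `g(0)`. -/
structure IsBurgersSolution (g : ℝ → ℝ) (T : ℝ) (u : ℝ → ℝ → ℝ) : Prop where
  aestronglyMeasurable :
    AEStronglyMeasurable (Function.uncurry u) (volume.restrict (Ioo 0 T ×ˢ (univ : Set ℝ)))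
  measurable_slice : ∀ t ∈ Icc 0 T, Measurable (u t)
  bounded : ∃ K : ℝ, ∀ t ∈ Icc 0 T, ∀ x, |u t x| ≤ K
  initial : u 0 =ᵐ[volume] g
  boundary : ∀ t ∈ Icc 0 T, Tendsto (u t) (𝓝[>] 0) (𝓝 (g 0))
  continuous_time : ∀ t ∈ Icc 0 T, ∀ a b : ℝ,
    Tendsto (fun s => ∫ x in a..b, |u s x - u t x|) (𝓝[Icc 0 T] t) (𝓝 0)
  weak : ∀ φ : ℝ × ℝ → ℝ, ContDiff ℝ ∞ φ → HasCompactSupport φ → tsupport φ ⊆ {p | p.1 < T} →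
    (∫ t in (0 : ℝ)..T, ∫ x,
      (u t x * fderiv ℝ φ (t, x) (1, 0) + u t x ^ 2 / 2 * fderiv ℝ φ (t, x) (0, 1)))
      + ∫ x, g x * φ (0, x) = 0
  entropy : ∃ K : ℝ, 0 ≤ K ∧ ∀ t ∈ Ioc 0 T, ∀ x z : ℝ, 0 < z →
    u t (x + z) - u t x ≤ K * (1 + 1 / t) * z

/-- The smooth step of half-width `γ = 1/5` centred at `x₀`. -/
noncomputable def initialStep (x₀ x : ℝ) : ℝ :=
  if x₀ + 1 / 5 < x then 0
  else if x < x₀ - 1 / 5 then 1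
  else 1 / 2 - 1 / 2 * Real.sin (Real.pi / (2 * (1 / 5)) * (x - x₀))

/-- The shock location. The step is odd about `(x₀, 1/2)`, so that the Rankine-Hugoniot speed is
`1/2` at all times. -/
noncomputable def shockLocation (x₀ t : ℝ) : ℝ := x₀ + t / 2

/-- The labels of the straight characteristics that are at the shock location at time `t`. -/
def shockLabels (x₀ t : ℝ) : Set ℝ := {ξ | ξ + t * initialStep x₀ ξ = shockLocation x₀ t}

/-- The interval of labels that the shock has absorbed at time `t` (empty before the shock). -/
noncomputable def absorbed (x₀ t : ℝ) : Set ℝ :=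
  Ioo (sInf (shockLabels x₀ t)) (sSup (shockLabels x₀ t))

open Classical in
/-- The characteristics `X(t,ξ)` of the entropy solution. -/
noncomputable def characteristic (x₀ t ξ : ℝ) : ℝ :=
  if ξ ∈ absorbed x₀ t then shockLocation x₀ t else ξ + t * initialStep x₀ ξ

/-- The entropy solution `u(·,t) = u₀ ∘ X(t,·)⁻¹`, with the generalised inverse of the
nondecreasing function `X(t,·)`. -/
noncomputable def burgersSolution (x₀ t x : ℝ) : ℝ :=
  initialStep x₀ (sInf {ξ | x ≤ characteristic x₀ t ξ})

end DeepReduction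

namespace DeepReduction

/-! ### Odd step profiles -/

/-! Write `u₀ = 1/2 - φ(· - x₀)/2` with an odd step `φ`. In the frame of the shock the label at
distance `s` from `x₀` sits at `s - t/2 φ(s)`. Since `φ(s)/s` decreases for `s > 0`, this position,
once positive, stays positive and increases; cutting it off at `0` on either side of the centre
therefore gives a monotone map (`relChar`, `relChar_mono`), which is the characteristic of the
statement up to a translation (`characteristic_eq`). Everything is proved for a general profile `φ`,
so that it applies both to the sine and to its piecewise linear interpolant `ψ`.

Weak formulation: slice `u` into its levels `l ∈ (0,1)`. Each level moves along a front, with speed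
`l` before it meets the shock and speed `1/2` afterwards. The absorbed levels are symmetric about
`1/2`, so the change of speed does not alter the total flux; this is the Rankine-Hugoniot condition
(`integral_levels`). After Fubini and a translation by the front, the weak identity is the
fundamental theorem of calculus along each front (`burgersSolution_weak`). Oleinik's inequality is
trivial because `u(t,·)` is nonincreasing.

Networks: degrees of freedom count only the reduced dimensions, never the full width `N` of an
activation. Padding and rescaling remove the orthonormality constraint (`exists_reducedActivation`),
so one activation on `ℝ⁴` can evaluate an interpolant `v` of `u₀` of any accuracy at a fixed cost. A
bisection step needs three such activations (`isRealizable_bisection`), and about `log(1/ε)` steps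
suffice.

Approximation: a threshold layer that jumps over the absorbed labels, followed by `ξ ↦ ξ + a v(ξ)`,
reproduces the characteristics well enough (`IsShockFit`). Bisection inverts this composition, the
same threshold layer maps the result to a label, and `v` evaluates the solution there. The output is
squeezed between small shifts of `u` up to a small error (`shockFit_estimate`). As both functions
have values in `[0,1]`, an `L¹` error below `ε²` gives an `L²` error below `ε` (`eLpNorm_sub_lt`).
-/

/-- An odd nondecreasing step whose secant slopes at `0` decrease on the positive half-line and
that is constant outside of `(-1/5, 1/5)`. -/
structure IsProfile (φ : ℝ → ℝ) : Prop where
  odd : ∀ s, φ (-s) = -φ s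
  mono : Monotone φ
  continuous : Continuous φ
  star : ∀ r s, 0 ≤ r → r ≤ s → r * φ s ≤ s * φ r
  saturated : ∀ s, 1 / 5 ≤ s → φ s = 1

namespace IsProfile

variable {φ : ℝ → ℝ}

theorem zero (hφ : IsProfile φ) : φ 0 = 0 := by
  have := hφ.odd 0
  simp only [neg_zero] at this
  linarith

theorem nonneg (hφ : IsProfile φ) {s : ℝ} (hs : 0 ≤ s) : 0 ≤ φ s :=
  hφ.zero ▸ hφ.mono hs

theorem le_one (hφ : IsProfile φ) (s : ℝ) : φ s ≤ 1 := by
  rw [← hφ.saturated (max s (1 / 5)) (le_max_right _ _)]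
  exact hφ.mono (le_max_left _ _)

theorem neg_one_le (hφ : IsProfile φ) (s : ℝ) : -1 ≤ φ s := by
  have h1 := hφ.le_one (-s)
  have h2 := hφ.odd s
  linarith

theorem saturated_neg (hφ : IsProfile φ) {s : ℝ} (hs : s ≤ -(1 / 5)) : φ s = -1 := by
  have h1 := hφ.saturated (-s) (by linarith)
  have h2 := hφ.odd s
  linarith

end IsProfile

/-- The displacement of the label `s` relative to the shock of the profile `φ` at time `t`. -/
noncomputable def relChar (φ : ℝ → ℝ) (t s : ℝ) : ℝ :=
  if 0 ≤ s then max (s - t / 2 * φ s) 0 else min (s - t / 2 * φ s) 0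

section relChar

variable {φ ψ : ℝ → ℝ} {t r s : ℝ}

theorem relChar_of_nonneg (hs : 0 ≤ s) : relChar φ t s = max (s - t / 2 * φ s) 0 := if_pos hs

theorem relChar_of_nonpos (hφ : IsProfile φ) (hs : s ≤ 0) :
    relChar φ t s = min (s - t / 2 * φ s) 0 := by
  rcases hs.lt_or_eq with h | rfl
  · exact if_neg h.not_ge
  · simp [relChar, hφ.zero]

theorem relChar_zero (hφ : IsProfile φ) : relChar φ t 0 = 0 := by
  simp [relChar, hφ.zero]

theorem relChar_nonpos (hφ : IsProfile φ) (hs : s ≤ 0) : relChar φ t s ≤ 0 := by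
  rw [relChar_of_nonpos hφ hs]; exact min_le_right _ _

theorem relChar_neg (hφ : IsProfile φ) : relChar φ t (-s) = -relChar φ t s := by
  rcases le_total 0 s with h | h
  · rw [relChar_of_nonneg h, relChar_of_nonpos hφ (by linarith), hφ.odd]
    rcases le_total (s - t / 2 * φ s) 0 with h1 | h1
    · rw [max_eq_right h1, min_eq_right (by linarith), neg_zero]
    · rw [max_eq_left h1, min_eq_left (by linarith)]; ring
  · rw [relChar_of_nonneg (s := -s) (by linarith), relChar_of_nonpos hφ h, hφ.odd]
    rcases le_total (s - t / 2 * φ s) 0 with h1 | h1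
    · rw [min_eq_left h1, max_eq_left (by linarith)]; ring
    · rw [min_eq_right h1, max_eq_right (by linarith), neg_zero]

theorem relChar_zero_time (s : ℝ) : relChar φ 0 s = s := by
  unfold relChar
  split_ifs with h
  · simpa using h
  · simpa using (not_le.1 h).le

/-- Along the positive half-line the relative characteristics lie below their chords. -/
theorem star_relative (hφ : IsProfile φ) (ht : 0 ≤ t) (hr : 0 ≤ r) (hrs : r ≤ s) :
    s * (r - t / 2 * φ r) ≤ r * (s - t / 2 * φ s) := by
  have := mul_le_mul_of_nonneg_left (hφ.star r s hr hrs) (show 0 ≤ t / 2 by linarith)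
  linarith

/-- The quotient `(s - t/2 φ(s))/s` is nondecreasing for `s > 0`. Multiplied by the increasing
factor `s`, a positive value must therefore grow strictly, although `s - t/2 φ(s)` itself need not
be monotone. -/
theorem relChar_lt_of_pos (hφ : IsProfile φ) (ht : 0 ≤ t) (hrs : r < s)
    (hr : 0 < relChar φ t r) : relChar φ t r < relChar φ t s := by
  have hr0 : 0 < r := by
    by_contra h
    exact (relChar_nonpos hφ (not_lt.1 h)).not_gt hr
  rw [relChar_of_nonneg hr0.le] at hr ⊢
  rw [relChar_of_nonneg (hr0.trans hrs).le]
  have h1 : 0 < r - t / 2 * φ r := by simpa using hr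
  rw [max_eq_left h1.le]
  have h2 := star_relative hφ ht hr0.le hrs.le
  refine lt_max_of_lt_left ?_
  by_contra h3
  push Not at h3
  nlinarith [mul_pos (sub_pos.2 hrs) h1, mul_le_mul_of_nonneg_left h3 hr0.le]

theorem relChar_lt_of_neg (hφ : IsProfile φ) (ht : 0 ≤ t) (hrs : r < s)
    (hs : relChar φ t s < 0) : relChar φ t r < relChar φ t s := by
  have := relChar_lt_of_pos hφ ht (neg_lt_neg hrs) (by rw [relChar_neg hφ]; linarith)
  rw [relChar_neg hφ, relChar_neg hφ] at this
  linarith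

theorem relChar_mono (hφ : IsProfile φ) (ht : 0 ≤ t) : Monotone (relChar φ t) := by
  intro r s hrs
  rcases hrs.lt_or_eq with h | rfl
  · rcases lt_trichotomy (relChar φ t r) 0 with h1 | h1 | h1
    · by_contra h2
      push Not at h2
      exact absurd (relChar_lt_of_neg hφ ht h (h2.trans h1)) h2.not_gt
    · rw [h1]
      by_contra h2
      push Not at h2
      have := relChar_lt_of_neg hφ ht h h2
      linarith
    · exact (relChar_lt_of_pos hφ ht h h1).le
  · exact le_rfl

/-- Cutting off at `0` is 1-Lipschitz, so the characteristics depend on the profile in a stable way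
and no comparison of the absorbed intervals is needed. -/
theorem abs_relChar_sub_profile_le (ht : 0 ≤ t) :
    |relChar φ t s - relChar ψ t s| ≤ t / 2 * |φ s - ψ s| := by
  have h : |(s - t / 2 * φ s) - (s - t / 2 * ψ s)| = t / 2 * |φ s - ψ s| := by
    rw [← abs_of_nonneg (show 0 ≤ t / 2 by linarith), ← abs_mul,
      abs_of_nonneg (show 0 ≤ t / 2 by linarith), abs_sub_comm]
    congr 1; ring
  unfold relChar
  split_ifs
  · exact (abs_max_sub_max_le_abs _ _ _).trans h.le
  · refine (abs_min_sub_min_le_max _ _ _ _).trans ?_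
    rw [h]; simp only [sub_self, abs_zero]
    exact max_le le_rfl (by positivity)

theorem continuous_relChar_time (φ : ℝ → ℝ) (s : ℝ) : Continuous fun t => relChar φ t s := by
  unfold relChar
  split_ifs <;> fun_prop

/-- In the laboratory frame the characteristics move to the right, with speed at most one. -/
theorem relChar_time_le (hφ : IsProfile φ) {t t' : ℝ} (h : t ≤ t') (s : ℝ) :
    t / 2 + relChar φ t s ≤ t' / 2 + relChar φ t' s ∧
      t' / 2 + relChar φ t' s ≤ t / 2 + relChar φ t s + (t' - t) := by
  have h1 := hφ.le_one s
  have h2 := hφ.neg_one_le s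
  have h3 : (t' - t) / 2 * φ s ≤ (t' - t) / 2 * 1 :=
    mul_le_mul_of_nonneg_left h1 (by linarith)
  have h4 : (t' - t) / 2 * (-1) ≤ (t' - t) / 2 * φ s :=
    mul_le_mul_of_nonneg_left h2 (by linarith)
  unfold relChar
  split_ifs <;> constructor
  · rw [← le_sub_iff_add_le']
    refine max_le ?_ ?_
    · linarith [le_max_left (s - t' / 2 * φ s) 0]
    · linarith [le_max_right (s - t' / 2 * φ s) 0]
  · rw [← le_sub_iff_add_le']
    refine max_le ?_ ?_
    · linarith [le_max_left (s - t / 2 * φ s) 0]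
    · linarith [le_max_right (s - t / 2 * φ s) 0]
  · rw [← sub_le_iff_le_add']
    refine le_min ?_ ?_
    · linarith [min_le_left (s - t / 2 * φ s) 0]
    · linarith [min_le_right (s - t / 2 * φ s) 0]
  · rw [add_assoc, ← sub_le_iff_le_add', ← sub_le_iff_le_add]
    refine le_min ?_ ?_
    · linarith [min_le_left (s - t' / 2 * φ s) 0]
    · linarith [min_le_right (s - t' / 2 * φ s) 0]

/-- The half-width of the interval of labels that the shock has absorbed. -/
theorem exists_shock_label (hφ : IsProfile φ) (ht : 0 ≤ t) :
    ∃ σ : ℝ, 0 ≤ σ ∧ σ - t / 2 * φ σ = 0 ∧ ∀ s, σ < s → 0 < s - t / 2 * φ s := by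
  have hc : Continuous fun s => s - t / 2 * φ s := by
    have := hφ.continuous
    fun_prop
  have hK : IsCompact (Icc 0 (t / 2) ∩ {s | s - t / 2 * φ s = 0}) :=
    isCompact_Icc.inter_right (isClosed_eq hc continuous_const)
  obtain ⟨σ, ⟨⟨h0, hσ⟩, hroot⟩, hmax⟩ :=
    hK.exists_isGreatest ⟨0, ⟨le_rfl, by linarith⟩, by simp [hφ.zero]⟩
  refine ⟨σ, h0, hroot, fun s hs => ?_⟩
  -- Since `φ ≤ 1`, the function is nonnegative at `t/2` and positive beyond it. A nonpositive value
  -- to the right of `σ` would thus produce a further root in `[0, t/2]`, but `σ` is the largest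
  -- one.
  by_contra hneg
  push Not at hneg
  have hst : s ≤ t / 2 := by
    have := mul_le_mul_of_nonneg_left (hφ.le_one s) (show 0 ≤ t / 2 by linarith)
    linarith
  have hend : 0 ≤ t / 2 - t / 2 * φ (t / 2) := by
    have := mul_le_mul_of_nonneg_left (hφ.le_one (t / 2)) (show 0 ≤ t / 2 by linarith)
    linarith
  obtain ⟨z, ⟨hz1, hz2⟩, hz⟩ := intermediate_value_Icc hst hc.continuousOn ⟨hneg, hend⟩
  have := hmax ⟨⟨by linarith, hz2⟩, hz⟩
  linarith

theorem relChar_eq_zero_of_abs_le (hφ : IsProfile φ) (ht : 0 ≤ t) {σ : ℝ}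
    (hσ : σ - t / 2 * φ σ = 0) (hs : |s| ≤ σ) : relChar φ t s = 0 := by
  have key : relChar φ t σ = 0 := by
    rw [relChar_of_nonneg ((abs_nonneg s).trans hs), hσ, max_self]
  have h1 := relChar_mono hφ ht (abs_le.1 hs).1
  have h2 := relChar_mono hφ ht (abs_le.1 hs).2
  rw [relChar_neg hφ] at h1
  linarith

theorem relChar_eq_of_le_abs (hφ : IsProfile φ) {σ : ℝ} (h0 : 0 ≤ σ)
    (hσ : σ - t / 2 * φ σ = 0) (hpos : ∀ s, σ < s → 0 < s - t / 2 * φ s) (hs : σ ≤ |s|) :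
    relChar φ t s = s - t / 2 * φ s := by
  have key : ∀ s, σ ≤ s → relChar φ t s = s - t / 2 * φ s := by
    intro s hs
    rw [relChar_of_nonneg (h0.trans hs)]
    apply max_eq_left
    rcases hs.lt_or_eq with h | rfl
    · exact (hpos s h).le
    · exact hσ.ge
  rcases le_total 0 s with h | h
  · exact key s (by rwa [abs_of_nonneg h] at hs)
  · have := key (-s) (by rwa [abs_of_nonpos h] at hs)
    rw [relChar_neg hφ, hφ.odd] at this
    linarith

end relChar

/-! ### The sine profile -/

/-- The profile of the smooth step. -/
noncomputable def sineProfile (s : ℝ) : ℝ :=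
  Real.sin (5 * Real.pi / 2 * max (-(1 / 5)) (min s (1 / 5)))

theorem initialStep_eq (x₀ x : ℝ) :
    initialStep x₀ x = 1 / 2 - 1 / 2 * sineProfile (x - x₀) := by
  unfold initialStep sineProfile
  split_ifs with h1 h2
  · rw [min_eq_right (by linarith), max_eq_right (by linarith),
      show 5 * Real.pi / 2 * (1 / 5) = Real.pi / 2 by ring, Real.sin_pi_div_two]
    norm_num
  · rw [min_eq_left (by linarith), max_eq_left (by linarith),
      show 5 * Real.pi / 2 * (-(1 / 5)) = -(Real.pi / 2) by ring, Real.sin_neg,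
      Real.sin_pi_div_two]
    norm_num
  · rw [min_eq_left (by linarith), max_eq_right (by linarith)]
    congr 3; ring

theorem sineProfile_eq_sin {s : ℝ} (h1 : -(1 / 5) ≤ s) (h2 : s ≤ 1 / 5) :
    sineProfile s = Real.sin (5 * Real.pi / 2 * s) := by
  rw [sineProfile, min_eq_left h2, max_eq_right h1]

theorem isProfile_sineProfile : IsProfile sineProfile where
  odd s := by
    unfold sineProfile
    rw [← Real.sin_neg]
    congr 1
    rw [← mul_neg]
    congr 1
    rcases le_total s (1 / 5) with h | h <;> rcases le_total (-(1 / 5)) s with h' | h'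
    · rw [min_eq_left h, max_eq_right h', min_eq_left (by linarith), max_eq_right (by linarith)]
    · rw [min_eq_left h, max_eq_left h', min_eq_right (by linarith), max_eq_right (by linarith)]
      ring
    · rw [min_eq_right h, min_eq_left (by linarith), max_eq_left (by linarith),
        max_eq_right (by norm_num)]
    · linarith
  mono r s hrs := by
    unfold sineProfile
    have hpi := Real.pi_pos
    have hmem : ∀ s : ℝ, 5 * Real.pi / 2 * max (-(1 / 5)) (min s (1 / 5)) ∈
        Icc (-(Real.pi / 2)) (Real.pi / 2) := by
      intro s
      have h1 : max (-(1 / 5 : ℝ)) (min s (1 / 5)) ≤ 1 / 5 :=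
        max_le (by norm_num) (min_le_right _ _)
      have h2 : -(1 / 5 : ℝ) ≤ max (-(1 / 5)) (min s (1 / 5)) := le_max_left _ _
      constructor <;> nlinarith
    exact Real.monotoneOn_sin (hmem r) (hmem s) (by gcongr)
  continuous := by unfold sineProfile; fun_prop
  star r s hr hrs := by
    unfold sineProfile
    have hpi := Real.pi_pos
    have hmin : ∀ s : ℝ, 0 ≤ s → -(1 / 5 : ℝ) ≤ min s (1 / 5) := fun s hs =>
      le_min (by linarith) (by norm_num)
    rw [max_eq_right (hmin r hr), max_eq_right (hmin s (hr.trans hrs))]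
    rcases le_total (1 / 5) r with h | h
    · rw [min_eq_right h, min_eq_right (h.trans hrs),
        show 5 * Real.pi / 2 * (1 / 5) = Real.pi / 2 by ring, Real.sin_pi_div_two]
      linarith
    · rw [min_eq_left h]
      set B := min s (1 / 5) with hB
      have hBs : B ≤ s := min_le_left _ _
      have hB5 : B ≤ 1 / 5 := min_le_right _ _
      have hrB : r ≤ B := le_min hrs h
      have hsin : 0 ≤ Real.sin (5 * Real.pi / 2 * r) :=
        Real.sin_nonneg_of_nonneg_of_le_pi (by positivity) (by nlinarith)
      rcases (hr.trans hrB).lt_or_eq with hB0 | hB0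
      · have hc := strictConcaveOn_sin_Icc.concaveOn.2 (x := 0) (y := 5 * Real.pi / 2 * B)
          ⟨le_rfl, hpi.le⟩ ⟨by positivity, by nlinarith⟩
          (show 0 ≤ 1 - r / B by
            rw [sub_nonneg]; exact (div_le_one hB0).2 hrB)
          (show 0 ≤ r / B by positivity) (by ring)
        simp only [smul_eq_mul, Real.sin_zero, mul_zero, zero_add] at hc
        rw [show r / B * (5 * Real.pi / 2 * B) = 5 * Real.pi / 2 * r by field_simp] at hc
        have := mul_le_mul_of_nonneg_left hc hB0.le
        rw [show B * (r / B * Real.sin (5 * Real.pi / 2 * B))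
          = r * Real.sin (5 * Real.pi / 2 * B) by field_simp] at this
        exact this.trans (mul_le_mul_of_nonneg_right hBs hsin)
      · have : r = 0 := by linarith
        simp [this]
  saturated s hs := by
    unfold sineProfile
    rw [min_eq_right hs, max_eq_right (by norm_num),
      show 5 * Real.pi / 2 * (1 / 5) = Real.pi / 2 by ring, Real.sin_pi_div_two]

theorem abs_sineProfile_sub_le (r s : ℝ) : |sineProfile r - sineProfile s| ≤ 8 * |r - s| := by
  unfold sineProfile
  refine (Real.abs_sin_sub_sin_le _ _).trans ?_
  rw [← mul_sub, abs_mul, abs_of_pos (by positivity)]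
  have h1 : |max (-(1 / 5)) (min r (1 / 5)) - max (-(1 / 5)) (min s (1 / 5))| ≤ |r - s| := by
    refine (abs_max_sub_max_le_max _ _ _ _).trans (max_le (by simp) ?_)
    exact (abs_min_sub_min_le_max _ _ _ _).trans (max_le le_rfl (by simp))
  have h2 : 5 * Real.pi / 2 ≤ 8 := by have := Real.pi_lt_d2; linarith
  exact mul_le_mul h2 h1 (abs_nonneg _) (by norm_num)

theorem initialStep_nonneg (x₀ x : ℝ) : 0 ≤ initialStep x₀ x := by
  rw [initialStep_eq]
  linarith [isProfile_sineProfile.le_one (x - x₀)]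

theorem initialStep_le_one (x₀ x : ℝ) : initialStep x₀ x ≤ 1 := by
  rw [initialStep_eq]
  linarith [isProfile_sineProfile.neg_one_le (x - x₀)]

theorem antitone_initialStep (x₀ : ℝ) : Antitone (initialStep x₀) := by
  intro x y hxy
  rw [initialStep_eq, initialStep_eq]
  linarith [isProfile_sineProfile.mono (sub_le_sub_right hxy x₀)]

theorem continuous_initialStep (x₀ : ℝ) : Continuous (initialStep x₀) := by
  have h : initialStep x₀ = fun x => 1 / 2 - 1 / 2 * sineProfile (x - x₀) :=
    funext (initialStep_eq x₀)
  have := isProfile_sineProfile.continuous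
  rw [h]
  fun_prop

theorem abs_initialStep_sub_le (x₀ x y : ℝ) :
    |initialStep x₀ x - initialStep x₀ y| ≤ 4 * |x - y| := by
  rw [initialStep_eq, initialStep_eq]
  have := abs_sineProfile_sub_le (x - x₀) (y - x₀)
  rw [show x - x₀ - (y - x₀) = x - y by ring] at this
  rw [show 1 / 2 - 1 / 2 * sineProfile (x - x₀) - (1 / 2 - 1 / 2 * sineProfile (y - x₀))
    = -(1 / 2) * (sineProfile (x - x₀) - sineProfile (y - x₀)) by ring, abs_mul]
  norm_num
  linarith

/-! ### Characteristics and the solution -/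

/-- By oddness the extreme shock labels are `x₀ ± σ` with the largest root `σ`. Between them the
cut-off position vanishes by monotonicity, and outside of them the cut-off is inactive. -/
theorem characteristic_eq (x₀ : ℝ) {t : ℝ} (ht : 0 ≤ t) (ξ : ℝ) :
    characteristic x₀ t ξ = x₀ + t / 2 + relChar sineProfile t (ξ - x₀) := by
  have hφ := isProfile_sineProfile
  obtain ⟨σ, h0, hroot, hpos⟩ := exists_shock_label hφ ht
  have hlab : ∀ ξ, ξ ∈ shockLabels x₀ t ↔ (ξ - x₀) - t / 2 * sineProfile (ξ - x₀) = 0 := by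
    intro ξ
    simp only [shockLabels, mem_ofPred_eq, shockLocation, initialStep_eq]
    constructor <;> intro h <;> linarith
  have hgreat : IsGreatest (shockLabels x₀ t) (x₀ + σ) := by
    refine ⟨(hlab _).2 (by simpa using hroot), fun ξ hξ => ?_⟩
    by_contra h
    push Not at h
    exact (hpos (ξ - x₀) (by linarith)).ne' ((hlab ξ).1 hξ)
  have hleast : IsLeast (shockLabels x₀ t) (x₀ - σ) := by
    refine ⟨(hlab _).2 ?_, fun ξ hξ => ?_⟩
    · rw [show x₀ - σ - x₀ = -σ by ring, hφ.odd]; linarith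
    · by_contra h
      push Not at h
      have h1 := hpos (-(ξ - x₀)) (by linarith)
      rw [hφ.odd] at h1
      linarith [(hlab ξ).1 hξ]
  have habs : ξ ∈ absorbed x₀ t ↔ |ξ - x₀| < σ := by
    rw [absorbed, hleast.csInf_eq, hgreat.csSup_eq, abs_lt, mem_Ioo]
    constructor <;> rintro ⟨h1, h2⟩ <;> constructor <;> linarith
  unfold characteristic
  split_ifs with h
  · rw [relChar_eq_zero_of_abs_le hφ ht hroot (habs.1 h).le, add_zero, shockLocation]
  · rw [relChar_eq_of_le_abs hφ h0 hroot hpos (not_lt.1 fun h' => h (habs.2 h')), initialStep_eq]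
    ring

theorem characteristic_mono (x₀ : ℝ) {t : ℝ} (ht : 0 ≤ t) : Monotone (characteristic x₀ t) := by
  intro ξ ζ h
  rw [characteristic_eq x₀ ht, characteristic_eq x₀ ht]
  linarith [relChar_mono isProfile_sineProfile ht (sub_le_sub_right h x₀)]

theorem characteristic_time_le (x₀ : ℝ) {t t' : ℝ} (ht : 0 ≤ t) (h : t ≤ t') (ξ : ℝ) :
    characteristic x₀ t ξ ≤ characteristic x₀ t' ξ ∧
      characteristic x₀ t' ξ ≤ characteristic x₀ t ξ + (t' - t) := by
  rw [characteristic_eq x₀ ht, characteristic_eq x₀ (ht.trans h)]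
  have := relChar_time_le isProfile_sineProfile h (ξ - x₀)
  constructor <;> linarith [this.1, this.2]

theorem characteristic_zero (x₀ ξ : ℝ) : characteristic x₀ 0 ξ = ξ := by
  rw [characteristic_eq x₀ le_rfl, relChar_zero_time]; ring

theorem le_characteristic (x₀ : ℝ) {t : ℝ} (ht : 0 ≤ t) (ξ : ℝ) :
    ξ ≤ characteristic x₀ t ξ ∧ characteristic x₀ t ξ ≤ ξ + t := by
  have := characteristic_time_le x₀ le_rfl ht ξ
  rw [characteristic_zero] at this
  constructor <;> linarith [this.1, this.2]

theorem preimage_nonempty (x₀ : ℝ) {t : ℝ} (ht : 0 ≤ t) (x : ℝ) :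
    {ξ | x ≤ characteristic x₀ t ξ}.Nonempty := ⟨x, (le_characteristic x₀ ht x).1⟩

theorem preimage_bddBelow (x₀ : ℝ) {t : ℝ} (ht : 0 ≤ t) (x : ℝ) :
    BddBelow {ξ | x ≤ characteristic x₀ t ξ} :=
  ⟨x - t, fun ξ hξ => by
    have h1 := (le_characteristic x₀ ht ξ).2
    have h2 : x ≤ characteristic x₀ t ξ := hξ
    linarith⟩

theorem le_burgersSolution (x₀ : ℝ) {t x ξ : ℝ} (ht : 0 ≤ t) (h : x ≤ characteristic x₀ t ξ) :
    initialStep x₀ ξ ≤ burgersSolution x₀ t x :=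
  antitone_initialStep x₀ (csInf_le (preimage_bddBelow x₀ ht x) h)

theorem burgersSolution_le (x₀ : ℝ) {t x ξ : ℝ} (ht : 0 ≤ t) (h : characteristic x₀ t ξ < x) :
    burgersSolution x₀ t x ≤ initialStep x₀ ξ := by
  refine antitone_initialStep x₀ (le_csInf (preimage_nonempty x₀ ht x) fun ζ hζ => ?_)
  by_contra h'
  push Not at h'
  have h1 := characteristic_mono x₀ ht h'.le
  have h2 : x ≤ characteristic x₀ t ζ := hζ
  linarith

theorem burgersSolution_nonneg (x₀ t x : ℝ) : 0 ≤ burgersSolution x₀ t x :=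
  initialStep_nonneg _ _

theorem burgersSolution_le_one (x₀ t x : ℝ) : burgersSolution x₀ t x ≤ 1 :=
  initialStep_le_one _ _

theorem antitone_burgersSolution (x₀ : ℝ) {t : ℝ} (ht : 0 ≤ t) :
    Antitone (burgersSolution x₀ t) := by
  intro x y hxy
  exact antitone_initialStep x₀ (csInf_le_csInf (preimage_bddBelow x₀ ht x)
    (preimage_nonempty x₀ ht y) fun ξ (hξ : y ≤ _) => hxy.trans hξ)

/-- `λ < u(t,x)` only if the label with the value `λ` has reached `x`. -/
theorem le_characteristic_of_lt_burgersSolution (x₀ : ℝ) {t x ξ : ℝ} (ht : 0 ≤ t)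
    (h : initialStep x₀ ξ < burgersSolution x₀ t x) : x ≤ characteristic x₀ t ξ := by
  by_contra h'
  push Not at h'
  exact (burgersSolution_le x₀ ht h').not_gt h

theorem burgersSolution_zero (x₀ x : ℝ) : burgersSolution x₀ 0 x = initialStep x₀ x := by
  unfold burgersSolution
  simp only [characteristic_zero]
  rw [show {ξ : ℝ | x ≤ ξ} = Ici x from rfl, csInf_Ici]

/-- The solution at a later time is squeezed between shifts of the solution at an earlier or
later time. -/
theorem burgersSolution_shift (x₀ : ℝ) {s t δ : ℝ} (hs : 0 ≤ s) (ht : 0 ≤ t) (hδ : |s - t| ≤ δ)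
    (x : ℝ) :
    burgersSolution x₀ s x ≤ burgersSolution x₀ t (x - δ) := by
  refine antitone_initialStep x₀ ?_
  refine csInf_le_csInf (preimage_bddBelow x₀ ht _) (preimage_nonempty x₀ hs x) ?_
  intro ξ (hξ : x ≤ _)
  show x - δ ≤ _
  have h := abs_le.1 hδ
  rcases le_total s t with hst | hst
  · linarith [(characteristic_time_le x₀ hs hst ξ).1, abs_nonneg (s - t)]
  · linarith [(characteristic_time_le x₀ ht hst ξ).2]

/-! ### Level coordinates -/

/-- The integral telescopes to the difference of the integrals of `f` over the windows of radius `δ`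
about `a` and `b`. The lemma serves both the continuity in time and the final `L²` bound. -/
theorem integral_shift_sub_le {f : ℝ → ℝ} (hf : Antitone f) (h0 : ∀ x, 0 ≤ f x)
    (h1 : ∀ x, f x ≤ 1) {a b δ : ℝ} (hδ : 0 ≤ δ) :
    ∫ x in a..b, (f (x - δ) - f (x + δ)) ≤ 2 * δ := by
  have hi : ∀ c d : ℝ, IntervalIntegrable f volume c d := fun c d => hf.intervalIntegrable
  have hi1 : IntervalIntegrable (fun x => f (x - δ)) volume a b :=
    Antitone.intervalIntegrable fun x y h => hf (by linarith)
  have hi2 : IntervalIntegrable (fun x => f (x + δ)) volume a b :=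
    Antitone.intervalIntegrable fun x y h => hf (by linarith)
  rw [intervalIntegral.integral_sub hi1 hi2, intervalIntegral.integral_comp_sub_right,
    intervalIntegral.integral_comp_add_right,
    intervalIntegral.integral_interval_sub_interval_comm (hi _ _) (hi _ _) (hi _ _)]
  have h2 : ∫ x in (a - δ)..(a + δ), f x ≤ 2 * δ := by
    have := intervalIntegral.integral_mono_on (μ := volume) (show a - δ ≤ a + δ by linarith)
      (hi _ _) (intervalIntegrable_const (c := (1 : ℝ))) (fun x _ => h1 x)
    simp only [intervalIntegral.integral_const, smul_eq_mul, mul_one] at this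
    linarith
  have h3 : 0 ≤ ∫ x in (b - δ)..(b + δ), f x :=
    intervalIntegral.integral_nonneg (by linarith) fun x _ => h0 x
  linarith

/-- The label, relative to the centre of the step, at which the sine profile has the value `p`. -/
noncomputable def levelLabel (p : ℝ) : ℝ := 2 / (5 * Real.pi) * Real.arcsin p

theorem continuous_levelLabel : Continuous levelLabel := by
  have := Real.continuous_arcsin
  unfold levelLabel
  fun_prop

theorem levelLabel_neg (p : ℝ) : levelLabel (-p) = -levelLabel p := by
  simp [levelLabel, Real.arcsin_neg]

theorem levelLabel_pos {p : ℝ} (hp : 0 < p) : 0 < levelLabel p := by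
  have := Real.arcsin_pos.2 hp
  have := Real.pi_pos
  unfold levelLabel
  positivity

theorem levelLabel_zero : levelLabel 0 = 0 := by simp [levelLabel]

theorem abs_levelLabel_le (p : ℝ) : |levelLabel p| ≤ 1 / 5 := by
  have hpi := Real.pi_pos
  have h : 1 / 5 = 2 / (5 * Real.pi) * (Real.pi / 2) := by field_simp
  rw [levelLabel, abs_mul, abs_of_pos (by positivity : 0 < 2 / (5 * Real.pi)), h]
  gcongr
  exact abs_le.2 ⟨Real.neg_pi_div_two_le_arcsin p, Real.arcsin_le_pi_div_two p⟩

theorem sineProfile_levelLabel {p : ℝ} (h1 : -1 ≤ p) (h2 : p ≤ 1) :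
    sineProfile (levelLabel p) = p := by
  have hpi := Real.pi_pos
  have h := abs_le.1 (abs_levelLabel_le p)
  rw [sineProfile_eq_sin h.1 h.2, levelLabel,
    show 5 * Real.pi / 2 * (2 / (5 * Real.pi) * Real.arcsin p) = Real.arcsin p by field_simp,
    Real.sin_arcsin h1 h2]

/-- The position at time `t` of the level `l` of the solution. -/
noncomputable def front (x₀ t l : ℝ) : ℝ :=
  x₀ + t / 2 + relChar sineProfile t (levelLabel (1 - 2 * l))

/-- The levels that the shock has absorbed at time `t`. -/
def absorbedLevels (t : ℝ) : Set ℝ :=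
  {l | |levelLabel (1 - 2 * l)| ≤ t / 2 * |1 - 2 * l|}

open Classical in
/-- The velocity of the level `l` of the solution. -/
noncomputable def levelSpeed (t l : ℝ) : ℝ := if l ∈ absorbedLevels t then 1 / 2 else l

theorem front_eq_characteristic (x₀ : ℝ) {t : ℝ} (ht : 0 ≤ t) (l : ℝ) :
    front x₀ t l = characteristic x₀ t (x₀ + levelLabel (1 - 2 * l)) := by
  rw [characteristic_eq x₀ ht, front]
  congr 2; ring

theorem initialStep_level (x₀ : ℝ) {l : ℝ} (hl : l ∈ Icc (0 : ℝ) 1) :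
    initialStep x₀ (x₀ + levelLabel (1 - 2 * l)) = l := by
  rw [initialStep_eq, add_sub_cancel_left,
    sineProfile_levelLabel (by linarith [hl.2]) (by linarith [hl.1])]
  ring

theorem measurable_front (x₀ : ℝ) : Measurable fun p : ℝ × ℝ => front x₀ p.1 p.2 := by
  have h1 := isProfile_sineProfile.continuous
  have h2 := continuous_levelLabel
  unfold front relChar
  refine Measurable.add (by fun_prop) (Measurable.ite (measurableSet_le ?_ ?_) ?_ ?_)
  all_goals fun_prop

theorem measurableSet_absorbedLevels :
    MeasurableSet {p : ℝ × ℝ | p.2 ∈ absorbedLevels p.1} := by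
  have h2 := continuous_levelLabel
  refine measurableSet_le (f := fun p : ℝ × ℝ => |levelLabel (1 - 2 * p.2)|)
    (g := fun p : ℝ × ℝ => p.1 / 2 * |1 - 2 * p.2|) ?_ ?_ <;> fun_prop

theorem measurable_levelSpeed : Measurable fun p : ℝ × ℝ => levelSpeed p.1 p.2 :=
  Measurable.ite measurableSet_absorbedLevels measurable_const measurable_snd

theorem abs_levelSpeed_le {t l : ℝ} (hl : l ∈ Icc (0 : ℝ) 1) : |levelSpeed t l| ≤ 1 := by
  unfold levelSpeed
  split_ifs
  · norm_num
  · exact abs_le.2 ⟨by linarith [hl.1], hl.2⟩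

theorem front_of_mem_absorbedLevels (x₀ : ℝ) {t l : ℝ} (hl : l ∈ Icc (0 : ℝ) 1)
    (h : l ∈ absorbedLevels t) : front x₀ t l = x₀ + t / 2 := by
  have hs := sineProfile_levelLabel (p := 1 - 2 * l) (by linarith [hl.2]) (by linarith [hl.1])
  have h' : |levelLabel (1 - 2 * l)| ≤ t / 2 * |1 - 2 * l| := h
  rw [front, add_eq_left]
  rcases lt_trichotomy 0 (1 - 2 * l) with hp | hp | hp
  · rw [relChar_of_nonneg (levelLabel_pos hp).le, hs]
    rw [abs_of_pos hp, abs_of_pos (levelLabel_pos hp)] at h'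
    exact max_eq_right (by linarith)
  · rw [← hp, levelLabel_zero, relChar_zero isProfile_sineProfile]
  · have h1 : levelLabel (1 - 2 * l) < 0 := by
      have := levelLabel_pos (neg_pos.2 hp)
      rw [levelLabel_neg] at this
      linarith
    rw [relChar_of_nonpos isProfile_sineProfile h1.le, hs]
    rw [abs_of_neg hp, abs_of_neg h1] at h'
    exact min_eq_right (by linarith)

/-- The excluded time is the one at which the level runs into the shock and its front has a kink.
The level `1/2` starts at the centre and travels with the shock at all times, so it has no kink. -/
theorem hasDerivAt_front (x₀ : ℝ) {t l : ℝ} (hl : l ∈ Icc (0 : ℝ) 1)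
    (h : 1 - 2 * l = 0 ∨ |levelLabel (1 - 2 * l)| ≠ t / 2 * |1 - 2 * l|) :
    HasDerivAt (fun t => front x₀ t l) (levelSpeed t l) t := by
  have hs := sineProfile_levelLabel (p := 1 - 2 * l) (by linarith [hl.2]) (by linarith [hl.1])
  have hshock : HasDerivAt (fun t : ℝ => x₀ + t / 2) (1 / 2) t := by
    simpa using ((hasDerivAt_id t).div_const 2).const_add x₀
  have hfree : HasDerivAt (fun t : ℝ => x₀ + t / 2 +
      (levelLabel (1 - 2 * l) - t / 2 * (1 - 2 * l))) l t := by
    have h1 := ((hasDerivAt_id t).div_const 2).mul_const (1 - 2 * l)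
    have h2 := hshock.add (h1.const_sub (levelLabel (1 - 2 * l)))
    refine h2.congr_deriv ?_
    ring
  have hc : Continuous fun t : ℝ => t / 2 * |1 - 2 * l| := by fun_prop
  rcases eq_or_ne (1 - 2 * l) 0 with hp | hp
  · have hmem : l ∈ absorbedLevels t := by
      simp [absorbedLevels, hp, levelLabel_zero]
    rw [levelSpeed, if_pos hmem]
    refine hshock.congr_of_eventuallyEq (Eventually.of_forall fun t => ?_)
    simp [front, hp, levelLabel_zero, relChar_zero isProfile_sineProfile]
  have hne := h.resolve_left hp
  rcases lt_or_gt_of_ne hne with h1 | h1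
  · rw [levelSpeed, if_pos (show l ∈ absorbedLevels t from h1.le)]
    refine hshock.congr_of_eventuallyEq ?_
    filter_upwards [continuous_const.continuousAt.eventually_lt hc.continuousAt h1] with r hr
    exact front_of_mem_absorbedLevels x₀ hl (show l ∈ absorbedLevels r from hr.le)
  · rw [levelSpeed, if_neg (show l ∉ absorbedLevels t from fun h' => h1.not_ge h')]
    refine hfree.congr_of_eventuallyEq ?_
    filter_upwards [hc.continuousAt.eventually_lt continuous_const.continuousAt h1] with r hr
    rw [front, add_right_inj]
    rcases lt_or_gt_of_ne hp with hp | hp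
    · have h2 : levelLabel (1 - 2 * l) < 0 := by
        have := levelLabel_pos (neg_pos.2 hp)
        rw [levelLabel_neg] at this
        linarith
      rw [relChar_of_nonpos isProfile_sineProfile h2.le, hs]
      rw [abs_of_neg hp, abs_of_neg h2] at hr
      exact min_eq_left (by linarith)
    · rw [relChar_of_nonneg (levelLabel_pos hp).le, hs]
      rw [abs_of_pos hp, abs_of_pos (levelLabel_pos hp)] at hr
      exact max_eq_left (by linarith)

theorem continuous_front_time (x₀ l : ℝ) : Continuous fun t => front x₀ t l := by
  have := continuous_relChar_time sineProfile (levelLabel (1 - 2 * l))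
  unfold front
  fun_prop

theorem abs_front_le (x₀ : ℝ) {t l : ℝ} (ht : 0 ≤ t) : |front x₀ t l| ≤ |x₀| + 1 / 5 + t := by
  rw [front_eq_characteristic x₀ ht]
  have h1 := le_characteristic x₀ ht (x₀ + levelLabel (1 - 2 * l))
  have h2 := abs_le.1 (abs_levelLabel_le (1 - 2 * l))
  have h3 := neg_abs_le x₀
  have h4 := le_abs_self x₀
  exact abs_le.2 ⟨by linarith [h1.1, h2.1], by linarith [h1.2, h2.2]⟩

/-- A level `m` strictly between `l` and `u(t,x)` has reached `x`, hence so has `l`. If `l` were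
exactly at `x`, the fronts of `l` and `m` would coincide, which happens only at the shock. -/
theorem lt_front_of_lt_burgersSolution (x₀ : ℝ) {t x l : ℝ} (ht : 0 ≤ t)
    (hl : l ∈ Ioo (0 : ℝ) 1) (hx : x ≠ x₀ + t / 2) (h : l < burgersSolution x₀ t x) :
    x < front x₀ t l := by
  obtain ⟨m, hlm, hm⟩ := exists_between h
  have hm1 : m ≤ 1 := hm.le.trans (burgersSolution_le_one x₀ t x)
  have h1 : x ≤ front x₀ t m := by
    rw [front_eq_characteristic x₀ ht]
    apply le_characteristic_of_lt_burgersSolution x₀ ht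
    rwa [initialStep_level x₀ ⟨by linarith [hl.1], hm1⟩]
  have h2 : levelLabel (1 - 2 * m) < levelLabel (1 - 2 * l) := by
    by_contra h'
    push Not at h'
    have := isProfile_sineProfile.mono h'
    rw [sineProfile_levelLabel (by linarith [hl.2]) (by linarith [hl.1]),
      sineProfile_levelLabel (by linarith) (by linarith [hl.1])] at this
    linarith
  have hφ := isProfile_sineProfile
  have hmono : front x₀ t m ≤ front x₀ t l := by
    unfold front; linarith [relChar_mono hφ ht h2.le]
  by_contra h'
  push Not at h'
  have heq : front x₀ t l = x := le_antisymm h' (h1.trans hmono)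
  have heq' : front x₀ t m = x := le_antisymm (hmono.trans h') h1
  unfold front at heq heq'
  rcases lt_trichotomy 0 (relChar sineProfile t (levelLabel (1 - 2 * m))) with h3 | h3 | h3
  · linarith [relChar_lt_of_pos hφ ht h2 h3]
  · exact hx (by linarith)
  · have := relChar_lt_of_neg hφ ht h2 (by linarith)
    linarith

theorem le_burgersSolution_of_lt_front (x₀ : ℝ) {t x l : ℝ} (ht : 0 ≤ t)
    (hl : l ∈ Icc (0 : ℝ) 1) (h : x < front x₀ t l) : l ≤ burgersSolution x₀ t x := by
  rw [front_eq_characteristic x₀ ht] at h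
  have := le_burgersSolution x₀ ht h.le
  rwa [initialStep_level x₀ hl] at this

open Classical in
/-- The absorbed levels have the mean `1/2`. -/
theorem integral_absorbedLevels (t : ℝ) :
    ∫ l in Ioo (0 : ℝ) 1, (if l ∈ absorbedLevels t then 1 / 2 - l else 0) = 0 := by
  rw [← integral_Ioc_eq_integral_Ioo, ← intervalIntegral.integral_of_le zero_le_one]
  set f : ℝ → ℝ := fun l => if l ∈ absorbedLevels t then 1 / 2 - l else 0 with hf
  have h1 : ∫ l in (0 : ℝ)..1, f (1 - l) = ∫ l in (0 : ℝ)..1, f l := by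
    simp [intervalIntegral.integral_comp_sub_left f]
  -- The reflection `l ↦ 1 - l` changes the sign of the level's label and hence preserves the set of
  -- absorbed levels.
  have h2 : ∀ l, f (1 - l) = -f l := by
    intro l
    have hm : 1 - l ∈ absorbedLevels t ↔ l ∈ absorbedLevels t := by
      have : 1 - 2 * (1 - l) = -(1 - 2 * l) := by ring
      simp only [absorbedLevels, mem_ofPred_eq, this, levelLabel_neg, abs_neg]
    simp only [hf, hm]
    split_ifs <;> ring
  simp only [h2, intervalIntegral.integral_neg] at h1
  linarith

open Classical in
-- Replacing the speed `l` by `1/2` on the absorbed levels costs a correction whose dependence on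
-- `l` factors out, because all these levels share one front. `integral_absorbedLevels` then removes
-- it. The level `l = u(t,x)` is left out because it may have reached `x` without passing it.
theorem levels_ae_eq (x₀ : ℝ) {t x : ℝ} (ht : 0 ≤ t) (hx : x ≠ x₀ + t / 2) (a b : ℝ) :
    ∀ᵐ l ∂(volume.restrict (Ioo (0 : ℝ) 1)),
      (if x < front x₀ t l then a + levelSpeed t l * b else 0) =
        (Iio (burgersSolution x₀ t x)).indicator (fun l => a + l * b) l +
        (if l ∈ absorbedLevels t then 1 / 2 - l else 0) * (if x < x₀ + t / 2 then b else 0) := by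
  have hne : ∀ᵐ l ∂(volume.restrict (Ioo (0 : ℝ) 1)), l ≠ burgersSolution x₀ t x :=
    ae_restrict_of_ae (Measure.ae_ne volume _)
  filter_upwards [hne, ae_restrict_mem measurableSet_Ioo] with l hlU hl
  generalize hU : burgersSolution x₀ t x = U at *
  have hl' := Ioo_subset_Icc_self hl
  have hiff : x < front x₀ t l ↔ l ∈ Iio U := by
    subst hU
    exact ⟨fun h => lt_of_le_of_ne (le_burgersSolution_of_lt_front x₀ ht hl' h) hlU,
      lt_front_of_lt_burgersSolution x₀ ht hl hx⟩
  by_cases hab : l ∈ absorbedLevels t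
  · have hf := front_of_mem_absorbedLevels x₀ hl' hab
    rw [hf] at hiff
    rw [hf, levelSpeed, if_pos hab, if_pos hab]
    by_cases h : x < x₀ + t / 2
    · rw [if_pos h, if_pos h, indicator_of_mem (hiff.1 h)]
      ring
    · rw [if_neg h, if_neg h, indicator_of_notMem fun h' => h (hiff.2 h')]
      ring
  · rw [levelSpeed, if_neg hab, if_neg hab, zero_mul, add_zero]
    by_cases h : x < front x₀ t l
    · rw [if_pos h, indicator_of_mem (hiff.1 h)]
    · rw [if_neg h, indicator_of_notMem fun h' => h (hiff.2 h')]

theorem integral_indicator_Iio_affine {U : ℝ} (hU0 : 0 ≤ U) (hU1 : U ≤ 1) (a b : ℝ) :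
    ∫ l in Ioo (0 : ℝ) 1, (Iio U).indicator (fun l => a + l * b) l = U * a + U ^ 2 / 2 * b := by
  have hset : Ioo (0 : ℝ) 1 ∩ Iio U = Ioo 0 U := by
    ext l
    simp only [mem_inter_iff, mem_Ioo, mem_Iio]
    constructor
    · rintro ⟨⟨h1, -⟩, h2⟩; exact ⟨h1, h2⟩
    · rintro ⟨h1, h2⟩; exact ⟨⟨h1, h2.trans_le hU1⟩, h2⟩
  rw [setIntegral_indicator measurableSet_Iio, hset, ← integral_Ioc_eq_integral_Ioo,
    ← intervalIntegral.integral_of_le hU0,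
    intervalIntegral.integral_add (by simp) ((by fun_prop :
      Continuous fun l : ℝ => l * b).intervalIntegrable _ _),
    intervalIntegral.integral_mul_const, integral_id, intervalIntegral.integral_const, smul_eq_mul]
  ring

/-- The solution and its flux are superpositions of moving fronts. -/
theorem integral_levels (x₀ : ℝ) {t x : ℝ} (ht : 0 ≤ t) (hx : x ≠ x₀ + t / 2) (a b : ℝ) :
    ∫ l in Ioo (0 : ℝ) 1, (if x < front x₀ t l then a + levelSpeed t l * b else 0)
      = burgersSolution x₀ t x * a + burgersSolution x₀ t x ^ 2 / 2 * b := by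
  classical
  have hmeas : MeasurableSet (absorbedLevels t) := by
    have h2 := continuous_levelLabel
    refine measurableSet_le (f := fun l : ℝ => |levelLabel (1 - 2 * l)|)
      (g := fun l : ℝ => t / 2 * |1 - 2 * l|) ?_ ?_ <;> fun_prop
  have hi : ∀ (s : Set ℝ) (f : ℝ → ℝ), MeasurableSet s → Continuous f →
      Integrable (s.indicator f) (volume.restrict (Ioo (0 : ℝ) 1)) := fun s f hs hf =>
    ((hf.integrableOn_Icc (a := 0) (b := 1)).mono_set Ioo_subset_Icc_self).indicator hs
  have hi1 := hi (Iio (burgersSolution x₀ t x)) (fun l => a + l * b) measurableSet_Iio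
    (by fun_prop)
  have hi2 : Integrable (fun l => if l ∈ absorbedLevels t then 1 / 2 - l else 0)
      (volume.restrict (Ioo (0 : ℝ) 1)) :=
    hi (absorbedLevels t) (fun l => 1 / 2 - l) hmeas (by fun_prop)
  rw [integral_congr_ae (levels_ae_eq x₀ ht hx a b), integral_add hi1 (hi2.mul_const _),
    integral_mul_const, integral_absorbedLevels, zero_mul, add_zero,
    integral_indicator_Iio_affine (burgersSolution_nonneg _ _ _) (burgersSolution_le_one _ _ _)]

/-! ### The weak formulation -/

theorem integrable_of_abs_le_indicator {β : Type*} [MeasurableSpace β] {m : Measure β}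
    {f : β → ℝ} {S : Set β} {M : ℝ} (hS : MeasurableSet S) (hm : m S ≠ ⊤)
    (hf : AEStronglyMeasurable f m) (hb : ∀ᵐ q ∂m, |f q| ≤ M) (hz : ∀ᵐ q ∂m, q ∉ S → f q = 0) :
    Integrable f m := by
  have h : IntegrableOn (fun _ : β => M) S m := integrableOn_const hm
  refine Integrable.mono' (h.integrable_indicator hS) hf ?_
  filter_upwards [hb, hz] with q h1 h2
  rw [Real.norm_eq_abs]
  by_cases hq : q ∈ S
  · rwa [indicator_of_mem hq]
  · rw [indicator_of_notMem hq, h2 hq, abs_zero]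

/-- The measure on pairs of a level and a distance to the front of this level. -/
noncomputable abbrev levelMeasure : Measure (ℝ × ℝ) := (volume.restrict (Ioo (0 : ℝ) 1)).prod volume

/-- The integrand of a level behind its front. -/
noncomputable def levelKernel (x₀ t : ℝ) (ψ₁ ψ₂ : ℝ → ℝ) (q : ℝ × ℝ) : ℝ :=
  if q.2 < 0 then ψ₁ (front x₀ t q.1 + q.2) + levelSpeed t q.1 * ψ₂ (front x₀ t q.1 + q.2) else 0

theorem ae_levelMeasure_mem : ∀ᵐ q ∂levelMeasure, q.1 ∈ Ioo (0 : ℝ) 1 :=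
  Measure.quasiMeasurePreserving_fst.ae (ae_restrict_mem measurableSet_Ioo)

theorem abs_add_levelSpeed_mul_le {M a b t l : ℝ} (hl : l ∈ Icc (0 : ℝ) 1) (ha : |a| ≤ M)
    (hb : |b| ≤ M) : |a + levelSpeed t l * b| ≤ 2 * M := by
  refine (abs_add_le _ _).trans ?_
  rw [abs_mul]
  have := mul_le_mul (abs_levelSpeed_le (t := t) hl) hb (abs_nonneg _) zero_le_one
  linarith

theorem levelMeasure_strip_ne_top (R : ℝ) :
    levelMeasure (univ ×ˢ Icc (-R) R) ≠ ⊤ := by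
  rw [levelMeasure, Measure.prod_prod]
  simp

theorem measurable_front_slice (x₀ t : ℝ) : Measurable (front x₀ t) := by
  have h : Measurable fun l : ℝ => (t, l) := by fun_prop
  have h' := (measurable_front x₀).comp h
  exact h'

theorem measurable_levelSpeed_slice (t : ℝ) : Measurable (levelSpeed t) := by
  have h : Measurable fun l : ℝ => (t, l) := by fun_prop
  have h' := measurable_levelSpeed.comp h
  exact h'

theorem measurable_levelSpeed_time (l : ℝ) : Measurable fun t => levelSpeed t l := by
  have h : Measurable fun t : ℝ => (t, l) := by fun_prop
  have h' := measurable_levelSpeed.comp h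
  exact h'

section

variable {x₀ t : ℝ} {ψ₁ ψ₂ : ℝ → ℝ} {M R : ℝ}

theorem integrable_levelKernel (ht : 0 ≤ t) (h₁ : Continuous ψ₁) (h₂ : Continuous ψ₂)
    (hb₁ : ∀ x, |ψ₁ x| ≤ M) (hb₂ : ∀ x, |ψ₂ x| ≤ M) (hz₁ : ∀ x, R < |x| → ψ₁ x = 0)
    (hz₂ : ∀ x, R < |x| → ψ₂ x = 0) : Integrable (levelKernel x₀ t ψ₁ ψ₂) levelMeasure := by
  have hM : 0 ≤ M := (abs_nonneg _).trans (hb₁ 0)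
  have hfr := measurable_front_slice x₀ t
  have hsp := measurable_levelSpeed_slice t
  have hmeas : Measurable (levelKernel x₀ t ψ₁ ψ₂) := by
    have h : Measurable fun q : ℝ × ℝ => front x₀ t q.1 + q.2 :=
      (hfr.comp measurable_fst).add measurable_snd
    exact Measurable.ite (measurableSet_lt measurable_snd measurable_const)
      ((h₁.measurable.comp h).add ((hsp.comp measurable_fst).mul (h₂.measurable.comp h)))
      measurable_const
  refine integrable_of_abs_le_indicator (S := univ ×ˢ Icc (-(R + (|x₀| + 1 / 5 + t)))
    (R + (|x₀| + 1 / 5 + t))) (M := 2 * M) (MeasurableSet.univ.prod measurableSet_Icc)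
    (levelMeasure_strip_ne_top _) hmeas.aestronglyMeasurable ?_ ?_
  · filter_upwards [ae_levelMeasure_mem] with q hq
    unfold levelKernel
    split_ifs
    · exact abs_add_levelSpeed_mul_le (Ioo_subset_Icc_self hq) (hb₁ _) (hb₂ _)
    · simpa using hM
  · refine Eventually.of_forall fun q hq => ?_
    have hq' : R + (|x₀| + 1 / 5 + t) < |q.2| := by
      by_contra h
      exact hq ⟨mem_univ _, abs_le.1 (not_lt.1 h)⟩
    have hR : R < |front x₀ t q.1 + q.2| := by
      have h1 := abs_front_le x₀ (l := q.1) ht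
      have h2 := abs_sub_abs_le_abs_sub q.2 (-front x₀ t q.1)
      rw [abs_neg, sub_neg_eq_add, add_comm q.2] at h2
      linarith
    unfold levelKernel
    rw [hz₁ _ hR, hz₂ _ hR]
    simp

/-- Fubini, then the substitution `x = front x₀ t l + z` for each level `l`. In the new variable the
region of integration is `z < 0`, which no longer depends on time, so that the time integral can
later be taken at fixed `(l, z)`. -/
theorem integral_superposition (ht : 0 ≤ t) (h₁ : Continuous ψ₁) (h₂ : Continuous ψ₂)
    (hb₁ : ∀ x, |ψ₁ x| ≤ M) (hb₂ : ∀ x, |ψ₂ x| ≤ M) (hz₁ : ∀ x, R < |x| → ψ₁ x = 0)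
    (hz₂ : ∀ x, R < |x| → ψ₂ x = 0) :
    ∫ x, (burgersSolution x₀ t x * ψ₁ x + burgersSolution x₀ t x ^ 2 / 2 * ψ₂ x)
      = ∫ q, levelKernel x₀ t ψ₁ ψ₂ q ∂levelMeasure := by
  have hM : 0 ≤ M := (abs_nonneg _).trans (hb₁ 0)
  have hfr := measurable_front_slice x₀ t
  have hsp := measurable_levelSpeed_slice t
  set F : ℝ → ℝ → ℝ := fun x l =>
    if x < front x₀ t l then ψ₁ x + levelSpeed t l * ψ₂ x else 0 with hF
  have hmeas : Measurable (Function.uncurry F) :=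
    Measurable.ite (measurableSet_lt measurable_fst (hfr.comp measurable_snd))
      ((h₁.measurable.comp measurable_fst).add
        ((hsp.comp measurable_snd).mul (h₂.measurable.comp measurable_fst))) measurable_const
  have hint : Integrable (Function.uncurry F)
      ((volume : Measure ℝ).prod (volume.restrict (Ioo (0 : ℝ) 1))) := by
    refine integrable_of_abs_le_indicator (S := Icc (-R) R ×ˢ univ) (M := 2 * M)
      (measurableSet_Icc.prod MeasurableSet.univ) ?_ hmeas.aestronglyMeasurable ?_ ?_
    · rw [Measure.prod_prod]
      simp
    · have hmem : ∀ᵐ q ∂((volume : Measure ℝ).prod (volume.restrict (Ioo (0 : ℝ) 1))),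
          q.2 ∈ Ioo (0 : ℝ) 1 :=
        Measure.quasiMeasurePreserving_snd.ae (ae_restrict_mem measurableSet_Ioo)
      filter_upwards [hmem] with q hq
      simp only [Function.uncurry, hF]
      split_ifs
      · exact abs_add_levelSpeed_mul_le (Ioo_subset_Icc_self hq) (hb₁ _) (hb₂ _)
      · simpa using hM
    · refine Eventually.of_forall fun q hq => ?_
      have hR : R < |q.1| := by
        by_contra h
        exact hq ⟨abs_le.1 (not_lt.1 h), mem_univ _⟩
      simp only [Function.uncurry, hF]
      rw [hz₁ _ hR, hz₂ _ hR]
      simp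
  have hae : ∀ᵐ x : ℝ, burgersSolution x₀ t x * ψ₁ x + burgersSolution x₀ t x ^ 2 / 2 * ψ₂ x
      = ∫ l in Ioo (0 : ℝ) 1, F x l := by
    filter_upwards [Measure.ae_ne volume (x₀ + t / 2)] with x hx
    exact (integral_levels x₀ ht hx (ψ₁ x) (ψ₂ x)).symm
  rw [integral_congr_ae hae, integral_integral_swap hint,
    integral_prod _ (integrable_levelKernel ht h₁ h₂ hb₁ hb₂ hz₁ hz₂)]
  refine integral_congr_ae (Eventually.of_forall fun l => ?_)
  show ∫ x, F x l = ∫ z, levelKernel x₀ t ψ₁ ψ₂ (l, z)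
  rw [← integral_add_left_eq_self (fun x => F x l) (front x₀ t l)]
  refine integral_congr_ae (Eventually.of_forall fun z => ?_)
  simp [hF, levelKernel]

end

/-- The fundamental theorem of calculus along a line parallel to the front of a level. -/
theorem integral_along_front (x₀ : ℝ) {φ : ℝ × ℝ → ℝ} (hφ : ContDiff ℝ ∞ φ) {l : ℝ}
    (hl : l ∈ Icc (0 : ℝ) 1) (T z : ℝ) :
    ∫ t in (0 : ℝ)..T, (fderiv ℝ φ (t, front x₀ t l + z) (1, 0) +
        levelSpeed t l * fderiv ℝ φ (t, front x₀ t l + z) (0, 1))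
      = φ (T, front x₀ T l + z) - φ (0, front x₀ 0 l + z) := by
  -- At most one time: the kink of the front where the shock absorbs the level.
  set s : Set ℝ := {t | 1 - 2 * l ≠ 0 ∧ |levelLabel (1 - 2 * l)| = t / 2 * |1 - 2 * l|} with hs
  have hcount : s.Countable := by
    refine Set.Subsingleton.countable fun t ht r hr => ?_
    have h1 : 0 < |1 - 2 * l| := abs_pos.2 ht.1
    have h2 : t / 2 * |1 - 2 * l| = r / 2 * |1 - 2 * l| := ht.2.symm.trans hr.2
    have := mul_right_cancel₀ h1.ne' h2
    linarith
  have hdiff : Differentiable ℝ φ := hφ.differentiable (by simp)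
  have hcf := continuous_front_time x₀ l
  have hcd : Continuous (fderiv ℝ φ) := hφ.continuous_fderiv (by simp)
  refine integral_eq_of_hasDerivAt_off_countable
    (fun t => φ (t, front x₀ t l + z)) _ hcount ?_ ?_ ?_
  · exact (hφ.continuous.comp (by fun_prop : Continuous fun t => (t, front x₀ t l + z))).continuousOn
  · rintro t ⟨-, hts⟩
    have hf := hasDerivAt_front x₀ (t := t) hl (by
      by_contra h
      push Not at h
      exact hts h)
    have h1 : HasDerivAt (fun t => (t, front x₀ t l + z)) (1, levelSpeed t l) t :=
      (hasDerivAt_id t).prodMk (hf.add_const z)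
    have h2 := (hdiff (t, front x₀ t l + z)).hasFDerivAt.comp_hasDerivAt t h1
    refine h2.congr_deriv ?_
    rw [show ((1 : ℝ), levelSpeed t l) = (1, 0) + levelSpeed t l • ((0 : ℝ), (1 : ℝ)) by simp,
      map_add, map_smul, smul_eq_mul]
  · have hsp := measurable_levelSpeed_time l
    have hcomp : ∀ w : ℝ × ℝ, Continuous fun t => fderiv ℝ φ (t, front x₀ t l + z) w := fun w =>
      (hcd.comp (by fun_prop : Continuous fun t => (t, front x₀ t l + z))).clm_apply
        continuous_const
    refine ((hcomp _).intervalIntegrable _ _).add ?_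
    have hi := (hcomp (0, 1)).intervalIntegrable (μ := volume) 0 T
    have hle : ∀ t, ‖levelSpeed t l‖ ≤ 1 := fun t => abs_levelSpeed_le hl
    exact ⟨Integrable.bdd_mul hi.1 hsp.aestronglyMeasurable (Eventually.of_forall hle),
      Integrable.bdd_mul hi.2 hsp.aestronglyMeasurable (Eventually.of_forall hle)⟩

theorem HasCompactSupport.exists_bounds {φ : ℝ × ℝ → ℝ} (hφ : ContDiff ℝ ∞ φ)
    (hc : HasCompactSupport φ) :
    ∃ M R : ℝ, (∀ p, |φ p| ≤ M) ∧ (∀ p, ‖fderiv ℝ φ p‖ ≤ M) ∧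
      (∀ p : ℝ × ℝ, R < |p.2| → φ p = 0) ∧ (∀ p : ℝ × ℝ, R < |p.2| → fderiv ℝ φ p = 0) := by
  have hcd : Continuous (fderiv ℝ φ) := hφ.continuous_fderiv (by simp)
  obtain ⟨M₁, h₁⟩ := hc.exists_bound_of_continuous hφ.continuous
  obtain ⟨M₂, h₂⟩ := (hc.fderiv ℝ).exists_bound_of_continuous hcd
  obtain ⟨R, hR⟩ := hc.isBounded.exists_norm_le
  have hout : ∀ p : ℝ × ℝ, R < |p.2| → p ∉ tsupport φ := fun p hp hmem =>
    absurd (hR p hmem) (not_le.2 (hp.trans_le (norm_snd_le p)))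
  refine ⟨max M₁ M₂, R, fun p => (h₁ p).trans (le_max_left _ _),
    fun p => (h₂ p).trans (le_max_right _ _), fun p hp => image_eq_zero_of_notMem_tsupport
      (hout p hp), fun p hp => ?_⟩
  by_contra h
  exact hout p hp (support_fderiv_subset ℝ h)

/-- In level coordinates the integrand at fixed `(l, z)` is the time derivative of the test function
along a front. It integrates to minus the initial value, since the test function vanishes at time
`T`. -/
theorem burgersSolution_weak (x₀ : ℝ) {T : ℝ} (hT : 0 ≤ T) {φ : ℝ × ℝ → ℝ}
    (hφ : ContDiff ℝ ∞ φ) (hc : HasCompactSupport φ) (hsupp : tsupport φ ⊆ {p | p.1 < T}) :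
    (∫ t in (0 : ℝ)..T, ∫ x,
      (burgersSolution x₀ t x * fderiv ℝ φ (t, x) (1, 0) +
        burgersSolution x₀ t x ^ 2 / 2 * fderiv ℝ φ (t, x) (0, 1)))
      + ∫ x, initialStep x₀ x * φ (0, x) = 0 := by
  obtain ⟨M, R, hb, hdb, hz, hdz⟩ := HasCompactSupport.exists_bounds hφ hc
  have hM : 0 ≤ M := (abs_nonneg _).trans (hb 0)
  have hcd : Continuous (fderiv ℝ φ) := hφ.continuous_fderiv (by simp)
  set D₁ : ℝ × ℝ → ℝ := fun p => fderiv ℝ φ p (1, 0) with hD₁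
  set D₂ : ℝ × ℝ → ℝ := fun p => fderiv ℝ φ p (0, 1) with hD₂
  have hc₁ : Continuous D₁ := hcd.clm_apply continuous_const
  have hc₂ : Continuous D₂ := hcd.clm_apply continuous_const
  have hDb : ∀ (p w : ℝ × ℝ), ‖w‖ ≤ 1 → |fderiv ℝ φ p w| ≤ M := fun p w hw =>
    ((fderiv ℝ φ p).le_opNorm w).trans
      (mul_le_of_le_one_right (norm_nonneg _) hw |>.trans (hdb p))
  have hb₁ : ∀ p, |D₁ p| ≤ M := fun p => hDb p _ (by simp)
  have hb₂ : ∀ p, |D₂ p| ≤ M := fun p => hDb p _ (by simp)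
  have hz₁ : ∀ p : ℝ × ℝ, R < |p.2| → D₁ p = 0 := fun p hp => by simp [hD₁, hdz p hp]
  have hz₂ : ∀ p : ℝ × ℝ, R < |p.2| → D₂ p = 0 := fun p hp => by simp [hD₂, hdz p hp]
  set K : ℝ → ℝ × ℝ → ℝ := fun t =>
    levelKernel x₀ t (fun x => D₁ (t, x)) (fun x => D₂ (t, x)) with hK
  have hstep : ∫ t in (0 : ℝ)..T, ∫ x,
      (burgersSolution x₀ t x * D₁ (t, x) + burgersSolution x₀ t x ^ 2 / 2 * D₂ (t, x))
      = ∫ t in Ioc 0 T, ∫ q, K t q ∂levelMeasure := by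
    rw [intervalIntegral.integral_of_le hT]
    refine setIntegral_congr_fun measurableSet_Ioc fun t ht => ?_
    exact integral_superposition ht.1.le (by fun_prop) (by fun_prop) (fun x => hb₁ _)
      (fun x => hb₂ _) (fun x hx => hz₁ (t, x) hx) (fun x hx => hz₂ (t, x) hx)
  have hKmeas : Measurable (Function.uncurry K) := by
    have hpair : Measurable fun q : ℝ × ℝ × ℝ => (q.1, q.2.1) := by fun_prop
    have hf := (measurable_front x₀).comp hpair
    have hs := measurable_levelSpeed.comp hpair
    have hp : Measurable fun q : ℝ × ℝ × ℝ => (q.1, front x₀ q.1 q.2.1 + q.2.2) :=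
      measurable_fst.prodMk (hf.add (measurable_snd.comp measurable_snd))
    exact Measurable.ite (measurableSet_lt (by fun_prop) measurable_const)
      ((hc₁.measurable.comp hp).add (hs.mul (hc₂.measurable.comp hp))) measurable_const
  have hKint : Integrable (Function.uncurry K) ((volume.restrict (Ioc 0 T)).prod levelMeasure) := by
    have hmem₁ : ∀ᵐ q ∂((volume.restrict (Ioc 0 T)).prod levelMeasure), q.1 ∈ Ioc 0 T :=
      Measure.quasiMeasurePreserving_fst.ae (ae_restrict_mem measurableSet_Ioc)
    have hmem₂ : ∀ᵐ q ∂((volume.restrict (Ioc 0 T)).prod levelMeasure),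
        q.2.1 ∈ Ioo (0 : ℝ) 1 :=
      Measure.quasiMeasurePreserving_snd.ae ae_levelMeasure_mem
    refine integrable_of_abs_le_indicator (S := univ ×ˢ (univ ×ˢ Icc (-(R + (|x₀| + 1 / 5 + T)))
      (R + (|x₀| + 1 / 5 + T)))) (M := 2 * M)
      (MeasurableSet.univ.prod (MeasurableSet.univ.prod measurableSet_Icc)) ?_
      hKmeas.aestronglyMeasurable ?_ ?_
    · rw [Measure.prod_prod]
      exact ENNReal.mul_ne_top (by simp) (levelMeasure_strip_ne_top _)
    · filter_upwards [hmem₂] with q hq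
      simp only [Function.uncurry, hK, levelKernel]
      split_ifs
      · exact abs_add_levelSpeed_mul_le (Ioo_subset_Icc_self hq) (hb₁ _) (hb₂ _)
      · simpa using hM
    · filter_upwards [hmem₁] with q hq hqS
      have hq' : R + (|x₀| + 1 / 5 + T) < |q.2.2| := by
        by_contra h
        exact hqS ⟨mem_univ _, mem_univ _, abs_le.1 (not_lt.1 h)⟩
      have hR : R < |front x₀ q.1 q.2.1 + q.2.2| := by
        have h1 := abs_front_le x₀ (l := q.2.1) hq.1.le
        have h2 := abs_sub_abs_le_abs_sub q.2.2 (-front x₀ q.1 q.2.1)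
        rw [abs_neg, sub_neg_eq_add, add_comm q.2.2] at h2
        linarith [hq.2]
      simp only [Function.uncurry, hK, levelKernel]
      rw [hz₁ (q.1, _) hR, hz₂ (q.1, _) hR]
      simp
  have hinner : ∀ᵐ q ∂levelMeasure, ∫ t in Ioc 0 T, K t q =
      -levelKernel x₀ 0 (fun x => φ (0, x)) (fun _ => 0) q := by
    filter_upwards [ae_levelMeasure_mem] with q hq
    simp only [hK, levelKernel]
    split_ifs with h
    · rw [← intervalIntegral.integral_of_le hT,
        integral_along_front x₀ hφ (Ioo_subset_Icc_self hq) T q.2]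
      have : φ (T, front x₀ T q.1 + q.2) = 0 :=
        image_eq_zero_of_notMem_tsupport fun h' => lt_irrefl T (hsupp h')
      rw [this]
      ring
    · simp
  -- The initial term is the same superposition at time `0`, with test function `φ(0,·)` for the
  -- density and `0` for the flux.
  have hinit := integral_superposition (x₀ := x₀) (t := 0) (M := M) (R := R) le_rfl
    (ψ₁ := fun x => φ (0, x)) (ψ₂ := fun _ => 0) (by have := hφ.continuous; fun_prop)
    continuous_const (fun x => hb _) (fun x => by simpa using hM) (fun x hx => hz (0, x) hx)
    (fun _ _ => rfl)
  simp only [burgersSolution_zero, mul_zero, add_zero] at hinit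
  rw [hstep, integral_integral_swap hKint, integral_congr_ae hinner, integral_neg, hinit]
  ring

/-! ### The entropy solution -/

/-- By monotonicity in the label, the infimum lies below `c` exactly if some rational label below
`c` has reached the point. This is a countable union of closed conditions. Negative times are
replaced by `0` so that the formula for the characteristics applies everywhere. -/
theorem measurable_uncurry_burgersSolution (x₀ : ℝ) :
    Measurable fun p : ℝ × ℝ => burgersSolution x₀ (max p.1 0) p.2 := by
  refine (continuous_initialStep x₀).measurable.comp (measurable_of_Iio fun c => ?_)
  have hset : (fun p : ℝ × ℝ => sInf {ξ | p.2 ≤ characteristic x₀ (max p.1 0) ξ}) ⁻¹' Iio c =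
      ⋃ q : {q : ℚ // (q : ℝ) < c}, {p : ℝ × ℝ | p.2 ≤
        x₀ + max p.1 0 / 2 + relChar sineProfile (max p.1 0) ((q.1 : ℝ) - x₀)} := by
    ext p
    have hp : 0 ≤ max p.1 0 := le_max_right _ _
    simp only [mem_preimage, mem_Iio, mem_iUnion, mem_ofPred_eq, Subtype.exists]
    simp only [← characteristic_eq x₀ hp]
    constructor
    · intro h
      obtain ⟨ξ, hξ, hξc⟩ := exists_lt_of_csInf_lt (preimage_nonempty x₀ hp p.2) h
      obtain ⟨q, hq1, hq2⟩ := exists_rat_btwn hξc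
      have hξ' : p.2 ≤ characteristic x₀ (max p.1 0) ξ := hξ
      exact ⟨q, hq2, hξ'.trans (characteristic_mono x₀ hp hq1.le)⟩
    · rintro ⟨q, hq, h⟩
      exact (csInf_le (preimage_bddBelow x₀ hp p.2) h).trans_lt hq
  rw [hset]
  refine MeasurableSet.iUnion fun q => ?_
  have hc := continuous_relChar_time sineProfile ((q.1 : ℝ) - x₀)
  have hc' : Continuous fun p : ℝ × ℝ => relChar sineProfile (max p.1 0) ((q.1 : ℝ) - x₀) :=
    hc.comp (by fun_prop : Continuous fun p : ℝ × ℝ => max p.1 0)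
  exact measurableSet_le measurable_snd (Continuous.measurable (by fun_prop))

theorem isBurgersSolution (x₀ : ℝ) (hx₀ : x₀ ∈ Ioo (1 / 5 : ℝ) (4 / 5)) :
    IsBurgersSolution (initialStep x₀) 3 (burgersSolution x₀) where
  aestronglyMeasurable := by
    refine (measurable_uncurry_burgersSolution x₀).aestronglyMeasurable.congr ?_
    filter_upwards [ae_restrict_mem (measurableSet_Ioo.prod MeasurableSet.univ)] with p hp
    rw [Function.uncurry, max_eq_left hp.1.1.le]
  measurable_slice t ht := (antitone_burgersSolution x₀ ht.1).measurable
  bounded := ⟨1, fun t _ x => abs_le.2 ⟨by linarith [burgersSolution_nonneg x₀ t x],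
    burgersSolution_le_one x₀ t x⟩⟩
  initial := Eventually.of_forall fun x => burgersSolution_zero x₀ x
  boundary t ht := by
    have h1 : ∀ x : ℝ, x ≤ x₀ - 1 / 5 → initialStep x₀ x = 1 := by
      intro x hx
      rw [initialStep_eq, isProfile_sineProfile.saturated_neg (by linarith)]
      norm_num
    rw [h1 0 (by linarith [hx₀.1])]
    refine tendsto_const_nhds.congr' ?_
    have hpos : (0 : ℝ) < x₀ - 1 / 5 := by linarith [hx₀.1]
    filter_upwards [mem_nhdsWithin_of_mem_nhds (Iio_mem_nhds hpos)] with x hx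
    refine le_antisymm ?_ (burgersSolution_le_one x₀ t x)
    rw [← h1 x (le_of_lt hx)]
    exact le_burgersSolution x₀ ht.1 (le_characteristic x₀ ht.1 x).1
  continuous_time t ht a b := by
    have hbound : ∀ s ∈ Icc (0 : ℝ) 3, ∀ a b : ℝ, a ≤ b →
        ∫ x in a..b, |burgersSolution x₀ s x - burgersSolution x₀ t x| ≤ 2 * |s - t| := by
      intro s hs a b hab
      have hanti := antitone_burgersSolution x₀ ht.1
      have hanti' := antitone_burgersSolution x₀ hs.1
      refine le_trans ?_ (integral_shift_sub_le hanti (burgersSolution_nonneg x₀ t)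
        (burgersSolution_le_one x₀ t) (a := a) (b := b) (abs_nonneg (s - t)))
      refine intervalIntegral.integral_mono_on hab ?_ ?_ fun x _ => ?_
      · exact (hanti'.intervalIntegrable.sub hanti.intervalIntegrable).abs
      · exact IntervalIntegrable.sub
          (Antitone.intervalIntegrable fun x y h => hanti (by linarith))
          (Antitone.intervalIntegrable fun x y h => hanti (by linarith))
      · have h1 := burgersSolution_shift x₀ hs.1 ht.1 le_rfl x
        have h2 := burgersSolution_shift x₀ ht.1 hs.1 (abs_sub_comm t s).le (x + |s - t|)
        rw [add_sub_cancel_right] at h2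
        have h3 : burgersSolution x₀ t (x + |s - t|) ≤ burgersSolution x₀ t x :=
          hanti (by linarith [abs_nonneg (s - t)])
        have h4 : burgersSolution x₀ t x ≤ burgersSolution x₀ t (x - |s - t|) :=
          hanti (by linarith [abs_nonneg (s - t)])
        exact abs_le.2 ⟨by linarith, by linarith⟩
    have hlim : Tendsto (fun s => 2 * |s - t|) (𝓝[Icc 0 3] t) (𝓝 0) := by
      have : Tendsto (fun s => 2 * |s - t|) (𝓝 t) (𝓝 (2 * |t - t|)) :=
        (by fun_prop : Continuous fun s => 2 * |s - t|).tendsto t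
      rw [sub_self, abs_zero, mul_zero] at this
      exact this.mono_left nhdsWithin_le_nhds
    refine squeeze_zero_norm' ?_ hlim
    filter_upwards [self_mem_nhdsWithin] with s hs
    have hnn : ∀ a b : ℝ, a ≤ b →
        0 ≤ ∫ x in a..b, |burgersSolution x₀ s x - burgersSolution x₀ t x| := fun a b hab =>
      intervalIntegral.integral_nonneg hab fun x _ => abs_nonneg _
    rw [Real.norm_eq_abs]
    rcases le_total a b with hab | hab
    · rw [abs_of_nonneg (hnn a b hab)]
      exact hbound s hs a b hab
    · rw [intervalIntegral.integral_symm, abs_neg, abs_of_nonneg (hnn b a hab)]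
      exact hbound s hs b a hab
  weak φ hφ hc hsupp := burgersSolution_weak x₀ (by norm_num) hφ hc hsupp
  -- The solution is nonincreasing in space, so `K = 0` works.
  entropy := ⟨0, le_rfl, fun t ht x z hz => by
    have := antitone_burgersSolution x₀ ht.1.le (show x ≤ x + z by linarith)
    linarith⟩

/-! ### Completion to orthonormal columns -/

open scoped MatrixOrder Matrix.Norms.L2Operator in
-- For small `c` the matrix `1 - c² VᵀV` is positive semidefinite, by Cauchy-Schwarz with the
-- squared Frobenius norm `S`, and `W` is a factor of it. Stacking `W` below `c V` makes the columns
-- orthonormal.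
theorem exists_orthonormal_completion {κ : Type*} [Fintype κ] {m : ℕ} (V : Matrix κ (Fin m) ℝ) :
    ∃ c : ℝ, 0 < c ∧ ∃ W : Matrix (Fin m) (Fin m) ℝ, (c • V)ᵀ * (c • V) + Wᵀ * W = 1 := by
  set S : ℝ := ∑ i, ∑ j, V i j ^ 2 with hS
  have hS0 : 0 ≤ S := Finset.sum_nonneg fun i _ => Finset.sum_nonneg fun j _ => sq_nonneg _
  set c : ℝ := 1 / (1 + S) with hc
  have hc0 : 0 < c := by positivity
  have hcS : c ^ 2 * S ≤ 1 := by
    rw [hc, div_pow, one_pow, div_mul_eq_mul_div, one_mul, div_le_one (by positivity)]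
    nlinarith
  have hpsd : (1 - (c • V)ᵀ * (c • V)).PosSemidef := by
    refine Matrix.PosSemidef.of_dotProduct_mulVec_nonneg ?_ fun x => ?_
    · rw [Matrix.IsHermitian]
      simp [Matrix.conjTranspose_eq_transpose_of_trivial, Matrix.transpose_mul]
    · have h1 : ∑ i, (∑ j, V i j * x j) ^ 2 ≤ S * ∑ j, x j ^ 2 := by
        rw [hS, Finset.sum_mul]
        exact Finset.sum_le_sum fun i _ => Finset.sum_mul_sq_le_sq_mul_sq _ _ _
      have h2 : star x ⬝ᵥ ((1 - (c • V)ᵀ * (c • V)) *ᵥ x)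
          = ∑ j, x j ^ 2 - c ^ 2 * ∑ i, (∑ j, V i j * x j) ^ 2 := by
        rw [Matrix.sub_mulVec, dotProduct_sub, Matrix.one_mulVec, ← Matrix.mulVec_mulVec,
          star_trivial, Matrix.dotProduct_mulVec, Matrix.vecMul_transpose, Matrix.smul_mulVec]
        simp only [dotProduct, Matrix.mulVec, Pi.smul_apply, smul_eq_mul]
        rw [Finset.mul_sum]
        congr 1
        · exact Finset.sum_congr rfl fun j _ => by ring
        · exact Finset.sum_congr rfl fun j _ => by ring
      rw [h2]
      have h3 : 0 ≤ ∑ j, x j ^ 2 := Finset.sum_nonneg fun j _ => sq_nonneg _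
      nlinarith [mul_le_mul_of_nonneg_left h1 (sq_nonneg c), mul_le_mul_of_nonneg_right hcS h3]
  obtain ⟨W, hW⟩ := CStarAlgebra.nonneg_iff_eq_star_mul_self.mp hpsd.nonneg
  refine ⟨c, hc0, W, ?_⟩
  rw [Matrix.star_eq_conjTranspose, Matrix.conjTranspose_eq_transpose_of_trivial] at hW
  rw [← hW]
  abel

theorem Activation.toFun_zero (a : Activation) : a.toFun 0 = 0 := by
  cases a <;> simp [Activation.toFun, DeepReduction.relu, DeepReduction.threshold]

/-- Up to scalings of the input and the output, the orthonormality of the columns is no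
restriction. -/
theorem exists_reducedActivation {κ : Type} [Fintype κ] {m : ℕ} (ρ : κ → Activation)
    (U V : Matrix κ (Fin m) ℝ) :
    ∃ ξ : ReducedActivation m, ∃ c d : ℝ, 0 < c ∧ 0 < d ∧ ∀ y,
      ξ.apply y = d • (Uᵀ *ᵥ fun i => (ρ i).toFun ((V *ᵥ (c • y)) i)) := by
  classical
  obtain ⟨c, hc, W, hW⟩ := exists_orthonormal_completion V
  obtain ⟨d, hd, W', hW'⟩ := exists_orthonormal_completion U
  let e : Fin (Fintype.card (κ ⊕ (Fin m ⊕ Fin m))) ≃ κ ⊕ (Fin m ⊕ Fin m) :=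
    (Fintype.equivFin _).symm
  -- The padding rows are staggered. The neurons that read through `W` are not sent to the output,
  -- and those that write through `W'` receive the input `0`, where both activations vanish.
  let V' : Matrix (κ ⊕ (Fin m ⊕ Fin m)) (Fin m) ℝ :=
    Matrix.fromRows (c • V) (Matrix.fromRows W 0)
  let U' : Matrix (κ ⊕ (Fin m ⊕ Fin m)) (Fin m) ℝ :=
    Matrix.fromRows (d • U) (Matrix.fromRows 0 W')
  have hsub : ∀ B : Matrix (κ ⊕ (Fin m ⊕ Fin m)) (Fin m) ℝ,
      (B.submatrix e id)ᵀ * B.submatrix e id = Bᵀ * B := by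
    intro B
    rw [Matrix.transpose_submatrix, Matrix.submatrix_mul_equiv, Matrix.submatrix_id_id]
  refine ⟨⟨_, fun i => Sum.elim ρ (fun _ => .relu) (e i), U'.submatrix e id, V'.submatrix e id,
    ?_, ?_⟩, c, d, hc, hd, fun y => ?_⟩
  · rw [hsub, ← hW']
    simp [U', Matrix.transpose_fromRows, Matrix.fromCols_mul_fromRows]
  · rw [hsub, ← hW]
    simp [V', Matrix.transpose_fromRows, Matrix.fromCols_mul_fromRows]
  · funext j
    simp only [ReducedActivation.apply, Matrix.mulVec, dotProduct, Matrix.transpose_apply,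
      Matrix.submatrix_apply, id_eq, Pi.smul_apply, smul_eq_mul]
    rw [Equiv.sum_comp e (fun k => U' k j *
      (Sum.elim ρ (fun _ => Activation.relu) k).toFun (∑ i, V' k i * y i))]
    simp only [Fintype.sum_sum_type, Sum.elim_inl, Sum.elim_inr, U', V', Matrix.fromRows_apply_inl,
      Matrix.fromRows_apply_inr, Matrix.smul_apply, Matrix.zero_apply, smul_eq_mul, zero_mul,
      Finset.sum_const_zero, Activation.toFun_zero, mul_zero, add_zero]
    rw [Finset.mul_sum]
    refine Finset.sum_congr rfl fun k _ => ?_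
    rw [mul_assoc]
    congr 4
    funext i
    ring

/-! ### Realizable families -/

/-- The map with the weights of `B` after the map with the weights of `P`. -/
def LayerWeights.comp {l m n : ℕ} (B : LayerWeights m n) (P : LayerWeights l m) :
    LayerWeights l n where
  weight := B.weight * P.weight
  bias := B.weight *ᵥ P.bias + B.bias

theorem LayerWeights.comp_apply {l m n : ℕ} (B : LayerWeights m n) (P : LayerWeights l m)
    (y : Fin l → ℝ) : (B.comp P).apply y = B.apply (P.apply y) := by
  simp only [LayerWeights.apply, LayerWeights.comp, Matrix.mulVec_add, Matrix.mulVec_mulVec]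
  abel

/-- The scaling by `c` as a layer. -/
def LayerWeights.scaling (m : ℕ) (c : ℝ) : LayerWeights m m where
  weight := c • 1
  bias := 0

theorem LayerWeights.scaling_apply {m : ℕ} (c : ℝ) (y : Fin m → ℝ) :
    (LayerWeights.scaling m c).apply y = c • y := by
  simp [LayerWeights.apply, LayerWeights.scaling, Matrix.smul_mulVec]

/-- A family of functions that is realized by one architecture with at most `d` degrees of
freedom; only the weights vary along the family. -/
def IsRealizable {ι : Type*} {m k : ℕ} (F : ι → (Fin m → ℝ) → (Fin k → ℝ)) (d : ℕ) : Prop :=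
  ∃ A : Architecture m k, A.dof ≤ d ∧ ∀ i, ∃ Γ : A.Weights, A.eval Γ = F i

section realizable

variable {ι : Type*} {l m k d : ℕ} {F : ι → (Fin m → ℝ) → (Fin k → ℝ)}

theorem isRealizable_layer (B : ι → LayerWeights m k) :
    IsRealizable (fun i => (B i).apply) (k * (m + 1)) :=
  ⟨.output m k, le_rfl, fun i => ⟨B i, rfl⟩⟩

/-- Two consecutive affine maps merge into one. As `l ≤ m`, the first weight matrix does not gain
columns, so the composition is free. -/
theorem IsRealizable.comp_layer (h : IsRealizable F d) (hl : l ≤ m) (P : ι → LayerWeights l m) :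
    IsRealizable (fun i y => F i ((P i).apply y)) d := by
  obtain ⟨A, hd, hA⟩ := h
  cases A with
  | output m k =>
    refine ⟨.output l k, le_trans (Nat.mul_le_mul_left k (by omega)) hd, fun i => ?_⟩
    obtain ⟨Γ, hΓ⟩ := hA i
    refine ⟨LayerWeights.comp Γ (P i), ?_⟩
    funext y
    exact (LayerWeights.comp_apply _ _ _).trans (congrFun hΓ _)
  | hidden m ξ rest =>
    refine ⟨.hidden l ξ rest, le_trans (Nat.add_le_add_right
      (Nat.mul_le_mul_left _ (by omega)) _) hd, fun i => ?_⟩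
    obtain ⟨Γ, hΓ⟩ := hA i
    refine ⟨(LayerWeights.comp Γ.1 (P i), Γ.2), ?_⟩
    funext y
    show rest.eval Γ.2 (ξ.apply ((LayerWeights.comp Γ.1 (P i)).apply y)) = _
    rw [LayerWeights.comp_apply]
    exact congrFun hΓ _

theorem IsRealizable.congr (h : IsRealizable F d) {G : ι → (Fin m → ℝ) → (Fin k → ℝ)}
    (hG : ∀ i y, G i y = F i y) : IsRealizable G d := by
  obtain rfl : G = F := funext fun i => funext fun y => hG i y
  exact h

/-- The maps `y ↦ Uᵀ (ρ ⊙ (V y))` with arbitrary matrices. -/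
def activationMaps (m : ℕ) : Submodule ℝ ((Fin m → ℝ) → (Fin m → ℝ)) where
  carrier := {Φ | ∃ (κ : Type) (_ : Fintype κ) (ρ : κ → Activation) (U V : Matrix κ (Fin m) ℝ),
    Φ = fun y => Uᵀ *ᵥ fun i => (ρ i).toFun ((V *ᵥ y) i)}
  zero_mem' := ⟨Empty, inferInstance, Empty.elim, 0, 0, by funext y; simp⟩
  add_mem' := by
    rintro _ _ ⟨κ, _, ρ, U, V, rfl⟩ ⟨κ', _, ρ', U', V', rfl⟩
    refine ⟨κ ⊕ κ', inferInstance, Sum.elim ρ ρ', Matrix.fromRows U U', Matrix.fromRows V V', ?_⟩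
    funext y j
    simp [Matrix.mulVec, dotProduct, Fintype.sum_sum_type]
  smul_mem' := by
    rintro c _ ⟨κ, _, ρ, U, V, rfl⟩
    refine ⟨κ, inferInstance, ρ, c • U, V, ?_⟩
    funext y j
    simp [Matrix.mulVec, dotProduct, Finset.mul_sum, mul_assoc]

/-- The scalings from `exists_reducedActivation` are undone by the adjacent affine layers. The cost
depends on `m` only, not on the number of neurons in `Φ`. -/
theorem IsRealizable.comp_activation (h : IsRealizable F d) {Φ : (Fin m → ℝ) → (Fin m → ℝ)}
    (hΦ : Φ ∈ activationMaps m) : IsRealizable (fun i y => F i (Φ y)) (d + m * (m + 1)) := by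
  obtain ⟨κ, _, ρ, U, V, rfl⟩ := hΦ
  obtain ⟨ξ, c, e, hc, he, hξ⟩ := exists_reducedActivation ρ U V
  obtain ⟨A, hd, hA⟩ := h.comp_layer le_rfl fun _ => LayerWeights.scaling m e⁻¹
  refine ⟨.hidden m ξ A, ?_, fun i => ?_⟩
  · show m * (m + 1) + A.dof ≤ _
    omega
  · obtain ⟨Γ, hΓ⟩ := hA i
    refine ⟨(LayerWeights.scaling m c⁻¹, Γ), ?_⟩
    funext y
    show A.eval Γ (ξ.apply ((LayerWeights.scaling m c⁻¹).apply y)) = _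
    rw [hΓ]
    show F i ((LayerWeights.scaling m e⁻¹).apply (ξ.apply _)) = F i _
    rw [LayerWeights.scaling_apply, LayerWeights.scaling_apply, hξ, smul_smul, smul_smul,
      inv_mul_cancel₀ he.ne', mul_inv_cancel₀ hc.ne', one_smul, one_smul]

/-- The linear combinations of activations of linear forms. -/
def activationSpan (m : ℕ) : Submodule ℝ ((Fin m → ℝ) → ℝ) :=
  Submodule.span ℝ {f | ∃ (a : Activation) (v : Fin m → ℝ), f = fun y => a.toFun (v ⬝ᵥ y)}

theorem activation_mem (a : Activation) (v : Fin m → ℝ) :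
    (fun y => a.toFun (v ⬝ᵥ y)) ∈ activationSpan m :=
  Submodule.subset_span ⟨a, v, rfl⟩

/-- From `s = σ(s) - σ(-s)`. This lets an activation pass some coordinates on unchanged while it
acts on others. -/
theorem linear_mem (v : Fin m → ℝ) : (fun y => v ⬝ᵥ y) ∈ activationSpan m := by
  have h := (activationSpan m).sub_mem (activation_mem .relu v) (activation_mem .relu (-v))
  convert h using 1
  funext y
  simp only [Activation.toFun, relu, Pi.sub_apply, neg_dotProduct]
  rcases le_total 0 (v ⬝ᵥ y) with h | h
  · rw [max_eq_right h, max_eq_left (by linarith), sub_zero]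
  · rw [max_eq_left h, max_eq_right (by linarith)]; ring

theorem coord_mem (j : Fin m) : (fun y : Fin m → ℝ => y j) ∈ activationSpan m := by
  simpa using linear_mem (Pi.single j (1 : ℝ))

theorem mem_activationMaps {Φ : (Fin m → ℝ) → (Fin m → ℝ)}
    (h : ∀ j, (fun y => Φ y j) ∈ activationSpan m) : Φ ∈ activationMaps m := by
  let E : Fin m → ((Fin m → ℝ) → ℝ) →ₗ[ℝ] ((Fin m → ℝ) → (Fin m → ℝ)) := fun j =>
    { toFun := fun f y => f y • Pi.single j (1 : ℝ)
      map_add' := fun f g => by funext y; simp [add_smul]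
      map_smul' := fun c f => by funext y; simp [mul_smul] }
  have hE : ∀ j, activationSpan m ≤ (activationMaps m).comap (E j) := by
    intro j
    refine Submodule.span_le.2 ?_
    rintro _ ⟨a, v, rfl⟩
    refine ⟨Unit, inferInstance, fun _ => a, Matrix.of fun _ => Pi.single j 1, Matrix.of fun _ => v, ?_⟩
    funext y i
    simp [E, Matrix.mulVec, dotProduct, mul_comm, Matrix.transpose_apply]
  have hsum : Φ = ∑ j, E j fun y => Φ y j := by
    funext y i
    simp [E, Finset.sum_apply, Pi.single_apply]
  rw [hsum]
  exact Submodule.sum_mem _ fun j _ => hE j (h j)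

end realizable

/-! ### Networks for the approximate inverse -/

/-- A function `v` of one variable that one reduced activation on `ℝ⁴` evaluates, from the third
coordinate and the constant `1` in the last coordinate. -/
def IsShallow (v : ℝ → ℝ) : Prop :=
  ∃ f ∈ activationSpan 4, ∀ y : Fin 4 → ℝ, y 3 = 1 → f y = v (y 2)

theorem isShallow_const (c : ℝ) : IsShallow fun _ => c := by
  refine ⟨_, (activationSpan 4).smul_mem c (coord_mem 3), fun y hy => ?_⟩
  simp [hy]

theorem isShallow_relu_sub (r : ℝ) : IsShallow fun x => relu (x - r) := by
  refine ⟨_, activation_mem .relu ![0, 0, 1, -r], fun y hy => ?_⟩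
  simp [Activation.toFun, dotProduct, Fin.sum_univ_four, hy, sub_eq_add_neg]

theorem IsShallow.add {v w : ℝ → ℝ} (hv : IsShallow v) (hw : IsShallow w) :
    IsShallow fun x => v x + w x := by
  obtain ⟨f, hf, hfv⟩ := hv
  obtain ⟨g, hg, hgw⟩ := hw
  exact ⟨_, (activationSpan 4).add_mem hf hg, fun y hy => by simp [hfv y hy, hgw y hy]⟩

theorem IsShallow.const_mul {v : ℝ → ℝ} (hv : IsShallow v) (c : ℝ) :
    IsShallow fun x => c * v x := by
  obtain ⟨f, hf, hfv⟩ := hv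
  exact ⟨_, (activationSpan 4).smul_mem c hf, fun y hy => by simp [hfv y hy]⟩

theorem isShallow_sum {κ : Type*} (s : Finset κ) {v : κ → ℝ → ℝ} (hv : ∀ k, IsShallow (v k)) :
    IsShallow fun x => ∑ k ∈ s, v k x := by
  classical
  induction s using Finset.induction_on with
  | empty => simpa using isShallow_const 0
  | insert a s ha ih =>
    simp only [Finset.sum_insert ha]
    exact (hv a).add ih

section

variable {ι : Type*} {k d : ℕ} {F : ι → (Fin 4 → ℝ) → (Fin k → ℝ)} {v : ℝ → ℝ}

theorem IsRealizable.comp_last (h : IsRealizable F d) {f : (Fin 4 → ℝ) → ℝ}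
    (hf : f ∈ activationSpan 4) :
    IsRealizable (fun i (y : Fin 4 → ℝ) => F i ![y 0, y 1, y 2, f y]) (d + 20) := by
  refine h.comp_activation (Φ := fun y => ![y 0, y 1, y 2, f y]) (mem_activationMaps fun j => ?_)
  fin_cases j
  · exact coord_mem 0
  · exact coord_mem 1
  · exact coord_mem 2
  · exact hf

theorem IsRealizable.comp_threshold (h : IsRealizable F d) :
    IsRealizable (fun i (y : Fin 4 → ℝ) => F i ![y 0, y 1, y 2, threshold (y 3)]) (d + 20) := by
  have := activation_mem .threshold (Pi.single (3 : Fin 4) (1 : ℝ))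
  simp only [single_dotProduct, one_mul] at this
  exact h.comp_last this

/-- The layer `y ↦ (y₀, y₁ + e y₃ + a, p ⬝ᵥ y + b, q ⬝ᵥ y + c)`. -/
def keepLayer (p q : Fin 4 → ℝ) (a b c e : ℝ) : LayerWeights 4 4 where
  weight := !![1, 0, 0, 0; 0, 1, 0, e; p 0, p 1, p 2, p 3; q 0, q 1, q 2, q 3]
  bias := ![0, a, b, c]

theorem keepLayer_apply (p q : Fin 4 → ℝ) (a b c e : ℝ) (y : Fin 4 → ℝ) :
    (keepLayer p q a b c e).apply y =
      ![y 0, y 1 + e * y 3 + a, p 0 * y 0 + p 1 * y 1 + p 2 * y 2 + p 3 * y 3 + b,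
        q 0 * y 0 + q 1 * y 1 + q 2 * y 2 + q 3 * y 3 + c] := by
  funext j
  fin_cases j <;>
    simp [LayerWeights.apply, keepLayer, dotProduct, Fin.sum_univ_four]

/-- A threshold layer, applied to the third coordinate. -/
theorem IsRealizable.comp_thresholdLayer (h : IsRealizable F d) (w b : ι → ℝ) (z : ι → ℝ) :
    IsRealizable (fun i (y : Fin 4 → ℝ) => F i ![y 0, y 1, thresholdLayer (w i) (b i) (y 2), z i]) (d + 20) := by
  have h1 := (h.comp_layer le_rfl fun i =>
    keepLayer ![0, 0, 1, w i] ![0, 0, 0, 0] 0 0 (z i) 0).comp_threshold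
  refine (h1.comp_layer le_rfl fun i =>
    keepLayer ![0, 0, 1, 0] ![0, 0, 1, 0] 0 0 (b i) 0).congr fun i y => ?_
  simp [keepLayer_apply, thresholdLayer]

/-- The function `v`, applied to the third coordinate. -/
theorem IsRealizable.comp_shallow (h : IsRealizable F d) (hv : IsShallow v) :
    IsRealizable (fun i (y : Fin 4 → ℝ) => F i ![y 0, y 1, y 2, v (y 2)]) (d + 20) := by
  obtain ⟨f, hf, hfv⟩ := hv
  refine ((h.comp_last hf).comp_layer le_rfl fun i =>
    keepLayer ![0, 0, 1, 0] ![0, 0, 0, 0] 0 0 1 0).congr fun i y => ?_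
  rw [keepLayer_apply, hfv _ (by simp)]
  simp

end

/-- The output `α y₂ + β y₃`. -/
theorem isRealizable_output {ι : Type*} (a b : ι → ℝ) :
    IsRealizable (fun i (y : Fin 4 → ℝ) (_ : Fin 1) => a i * y 2 + b i * y 3) 5 := by
  refine (isRealizable_layer fun i =>
    (⟨!![0, 0, a i, b i], 0⟩ : LayerWeights 4 1)).congr fun i y => ?_
  funext j
  fin_cases j
  simp [LayerWeights.apply, dotProduct, Fin.sum_univ_four]

/-- The length of the interval after a step does not depend on the outcome, so a network has to
store only the left end, which is an affine function of the threshold. -/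
theorem bisectStep_eq (g : ℝ → ℝ) (x a h : ℝ) :
    bisectStep g x (a, a + h) = (a + h / 2 * (1 - threshold (g (a + h / 2) - x)),
      a + h / 2 * (1 - threshold (g (a + h / 2) - x)) + h / 2) := by
  have hm : (a + (a + h)) / 2 = a + h / 2 := by ring
  unfold bisectStep
  simp only [hm]
  unfold threshold
  by_cases h0 : 0 < g (a + h / 2) - x
  · simp [h0]
  · simp [h0]
    ring

section

variable {ι : Type*} {v : ℝ → ℝ} (w₁ b₁ w w₂ b₂ : ι → ℝ)

/-- `v ∘ T₂` after `n` bisection steps on the interval `(y₁, y₁ + h)` for the value `y₀`. -/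
theorem isRealizable_bisection (hv : IsShallow v) (n : ℕ) (h : ℝ) :
    IsRealizable (fun i (y : Fin 4 → ℝ) (_ : Fin 1) =>
      v (thresholdLayer (w₂ i) (b₂ i)
        ((((bisectStep ((fun x => x + w i * v x) ∘ thresholdLayer (w₁ i) (b₁ i)) (y 0))^[n]
            (y 1, y 1 + h)).1 +
          ((bisectStep ((fun x => x + w i * v x) ∘ thresholdLayer (w₁ i) (b₁ i)) (y 0))^[n]
            (y 1, y 1 + h)).2) / 2))) (60 * n + 45) := by
  induction n generalizing h with
  | zero =>
    -- The coordinates hold the value `x`, the left end, an argument and a scratch entry. Layers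
    -- written later act earlier. The cost is `5` for the output and `20` each for `v` and `T₂`.
    have h1 := (((isRealizable_output (ι := ι) (fun _ => 0) (fun _ => 1)).comp_shallow
      hv).comp_thresholdLayer w₂ b₂ fun _ => 0).comp_layer le_rfl fun _ =>
        keepLayer ![0, 1, 0, 0] ![0, 0, 0, 0] 0 (h / 2) 0 0
    refine h1.congr fun i y => ?_
    funext j
    simp only [keepLayer_apply, Function.iterate_zero, id_eq]
    have : (y 1 + (y 1 + h)) / 2 = y 1 + h / 2 := by ring
    simp [this]
  | succ n ih =>
    -- One bisection step goes in front of the remaining `n`. In the order of evaluation, `h3` moves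
    -- the midpoint to the third coordinate, `h2` applies `T₁₁` and `v` and forms `g(m) - x`, and
    -- `h1` takes the threshold and updates the left end. These are three activations on `ℝ⁴`, hence
    -- the `60`.
    have h1 := ((ih (h / 2)).comp_layer le_rfl fun _ =>
      keepLayer ![0, 0, 0, 0] ![0, 0, 0, 0] (h / 2) 0 0 (-(h / 2))).comp_threshold
    have h2 := ((h1.comp_layer le_rfl fun i =>
      keepLayer ![0, 0, 0, 0] ![-1, 0, 1, w i] 0 0 0 0).comp_shallow
        hv).comp_thresholdLayer w₁ b₁ fun _ => 0
    have h3 := h2.comp_layer le_rfl fun _ =>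
      keepLayer ![0, 1, 0, 0] ![0, 0, 0, 0] 0 (h / 2) 0 0
    rw [show 60 * (n + 1) + 45 = 60 * n + 45 + 20 + 20 + 20 by ring]
    refine h3.congr fun i y => ?_
    funext j
    rw [Function.iterate_succ_apply, bisectStep_eq]
    have hA : ∀ θ : ℝ, y 1 + -(h / 2 * threshold (-y 0 + θ + w i * v θ)) + h / 2 =
        y 1 + h / 2 * (1 - threshold (θ + w i * v θ - y 0)) := fun θ => by
      rw [show -y 0 + θ + w i * v θ = θ + w i * v θ - y 0 by ring]
      ring
    simp [keepLayer_apply, hA]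

theorem exists_architecture (hv : IsShallow v) (n : ℕ) :
    ∃ A : Architecture 1 1, A.dof ≤ 60 * n + 45 ∧ ∀ i, ∃ Γ : A.Weights,
      A.realize Γ = v ∘ thresholdLayer (w₂ i) (b₂ i) ∘
        approxInverse ((fun x => x + w i * v x) ∘ thresholdLayer (w₁ i) (b₁ i)) n := by
  -- The input goes to the coordinate `0`; the left end `0` and the length `1` give the initial
  -- interval `(0,1)`.
  obtain ⟨A, hA, h⟩ := (isRealizable_bisection w₁ b₁ w w₂ b₂ hv n 1).comp_layer
    (l := 1) (by norm_num) fun _ => (⟨!![1; 0; 0; 0], 0⟩ : LayerWeights 1 4)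
  refine ⟨A, hA, fun i => ?_⟩
  obtain ⟨Γ, hΓ⟩ := h i
  refine ⟨Γ, ?_⟩
  funext x
  rw [Architecture.realize, hΓ]
  have h0 : ((⟨!![1; 0; 0; 0], 0⟩ : LayerWeights 1 4).apply fun _ => x) 0 = x := by
    simp [LayerWeights.apply, dotProduct]
  have h1 : ((⟨!![1; 0; 0; 0], 0⟩ : LayerWeights 1 4).apply fun _ => x) 1 = 0 := by
    simp [LayerWeights.apply, dotProduct]
  simp only [h0, h1, zero_add]
  rfl

end

/-! ### Membership in the network classes. -/

theorem mem_rdn_of_isRealizable {F : Unit → (Fin 4 → ℝ) → (Fin 1 → ℝ)} {d : ℕ}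
    (h : IsRealizable F d) {f : ℝ → ℝ} (hf : ∀ x, F () ![0, 0, x, 0] 0 = f x) : f ∈ rdn := by
  obtain ⟨A, -, h⟩ := h.comp_layer (l := 1) (by norm_num)
    fun _ => (⟨!![0; 0; 1; 0], 0⟩ : LayerWeights 1 4)
  obtain ⟨Γ, hΓ⟩ := h ()
  refine ⟨A, Γ, ?_⟩
  funext x
  rw [Architecture.realize, hΓ, ← hf]
  have : (⟨!![0; 0; 1; 0], 0⟩ : LayerWeights 1 4).apply (fun _ => x) = ![0, 0, x, 0] := by
    funext j
    fin_cases j <;> simp [LayerWeights.apply, dotProduct]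
  simp only [this]

theorem thresholdLayer_mem_rdn (w b : ℝ) : thresholdLayer w b ∈ rdn :=
  mem_rdn_of_isRealizable ((isRealizable_output (fun _ => 1) fun _ => 0).comp_thresholdLayer
    (fun _ => w) (fun _ => b) fun _ => 0) fun x => by simp

theorem IsShallow.mem_rdn {v : ℝ → ℝ} (hv : IsShallow v) : v ∈ rdn :=
  mem_rdn_of_isRealizable ((isRealizable_output (fun _ => 0) fun _ => 1).comp_shallow hv)
    fun x => by simp

theorem IsShallow.comp_thresholdLayer_mem_rdn {v : ℝ → ℝ} (hv : IsShallow v) (w w₁ b₁ : ℝ) :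
    (fun x => x + w * v x) ∘ thresholdLayer w₁ b₁ ∈ rdn :=
  mem_rdn_of_isRealizable (((isRealizable_output (fun _ => 1) fun _ => w).comp_shallow
    hv).comp_thresholdLayer (fun _ => w₁) (fun _ => b₁) fun _ => 0) fun x => by simp

theorem rdnMats_of_isSingularMats {v f : ℝ → ℝ} {n : ℕ} (hv : v ∈ rdn)
    (h : IsSingularMats v n f) : f ∈ rdnMats := by
  obtain ⟨w₁₁₁, w₁₁₂, w₁₂, w₂₁, w₂₂, -, h₂, h₁, hne, rfl⟩ := h
  refine ⟨v, hv, [thresholdLayer w₂₁ w₂₂,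
    approxInverse ((fun x => x + w₁₂ * v x) ∘ thresholdLayer w₁₁₁ w₁₁₂) n], ?_, rfl⟩
  intro T hT
  simp only [List.mem_cons, List.not_mem_nil, or_false] at hT
  rcases hT with rfl | rfl
  · exact Or.inl h₂
  · exact Or.inr ⟨_, h₁, hne, n, rfl⟩

/-! ### Piecewise linear profiles -/

/-- The projection of `s` to `[-r, r]`, as a combination of rectified linear units. -/
noncomputable def reluClamp (r s : ℝ) : ℝ := relu (s + r) - relu (s - r) - r

theorem reluClamp_eq {r : ℝ} (hr : 0 ≤ r) (s : ℝ) : reluClamp r s = max (-r) (min s r) := by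
  unfold reluClamp relu
  rcases le_total s r with h | h
  · rw [min_eq_left h, max_eq_left (by linarith : s - r ≤ 0)]
    rcases le_total (-r) s with h' | h'
    · rw [max_eq_right h', max_eq_right (by linarith)]; ring
    · rw [max_eq_left h', max_eq_left (by linarith)]; ring
  · rw [min_eq_right h, max_eq_right (by linarith : 0 ≤ s - r), max_eq_right (by linarith),
      max_eq_right (by linarith)]
    ring

theorem reluClamp_of_nonneg {r s : ℝ} (hr : 0 ≤ r) (hs : 0 ≤ s) : reluClamp r s = min s r := by
  rw [reluClamp_eq hr, max_eq_right]
  exact le_min (by linarith) (by linarith)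

theorem reluClamp_neg (r s : ℝ) : reluClamp r (-s) = -reluClamp r s := by
  have h : ∀ x, relu (-x) = relu x - x := by
    intro x
    unfold relu
    rcases le_total 0 x with h | h
    · rw [max_eq_left (by linarith), max_eq_right h]; ring
    · rw [max_eq_right (by linarith), max_eq_left h]; ring
  unfold reluClamp
  rw [show -s + r = -(s - r) by ring, show -s - r = -(s + r) by ring, h, h]
  ring

theorem reluClamp_mono {r : ℝ} (hr : 0 ≤ r) : Monotone (reluClamp r) := by
  intro s s' h
  rw [reluClamp_eq hr, reluClamp_eq hr]
  gcongr

theorem reluClamp_star {r a b : ℝ} (hr : 0 ≤ r) (ha : 0 ≤ a) (hab : a ≤ b) :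
    a * reluClamp r b ≤ b * reluClamp r a := by
  rw [reluClamp_of_nonneg hr ha, reluClamp_of_nonneg hr (ha.trans hab)]
  rcases le_total a r with h | h
  · rw [min_eq_left h, mul_comm b a]
    exact mul_le_mul_of_nonneg_left (min_le_left _ _) ha
  · rw [min_eq_right h, min_eq_right (h.trans hab)]
    exact mul_le_mul_of_nonneg_right hab hr

theorem continuous_reluClamp (r : ℝ) : Continuous (reluClamp r) := by
  unfold reluClamp relu
  fun_prop

/-- The slope of the sine profile over the cell with the number `i` of the mesh width `κ`. -/
noncomputable def meshSlope (κ : ℝ) (i : ℕ) : ℝ :=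
  (sineProfile ((i + 1) * κ) - sineProfile (i * κ)) / κ

/-- The piecewise linear interpolant of the sine profile with `N` cells on `[0, 1/5]`. -/
noncomputable def meshProfile (N : ℕ) (s : ℝ) : ℝ :=
  ∑ i ∈ Finset.range N, (meshSlope (1 / (5 * N)) i - meshSlope (1 / (5 * N)) (i + 1)) *
    reluClamp ((i + 1) * (1 / (5 * N))) s

section mesh

variable {N : ℕ}

theorem mesh_mul (hN : 0 < N) : (N : ℝ) * (1 / (5 * N)) = 1 / 5 := by
  have : (N : ℝ) ≠ 0 := by exact_mod_cast hN.ne'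
  field_simp

/-- By the addition formulas the left side is `2 sin a cos b ≤ 2 sin a`. -/
theorem sineProfile_concave {x κ : ℝ} (hκ : 0 ≤ κ) (hκx : κ ≤ x) (hx : x + κ ≤ 1 / 5) :
    sineProfile (x - κ) + sineProfile (x + κ) ≤ 2 * sineProfile x := by
  have hpi := Real.pi_pos
  have h0 := isProfile_sineProfile.nonneg (hκ.trans hκx)
  rw [sineProfile_eq_sin (by linarith) (by linarith)] at h0
  rw [sineProfile_eq_sin (s := x - κ) (by linarith) (by linarith),
    sineProfile_eq_sin (s := x + κ) (by linarith) hx,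
    sineProfile_eq_sin (s := x) (by linarith) (by linarith),
    mul_sub, mul_add, Real.sin_sub, Real.sin_add]
  nlinarith [Real.cos_le_one (5 * Real.pi / 2 * κ)]

/-- Concavity of the sine inside the step. For the last cell, the next slope is `0` by saturation.
-/
theorem meshSlope_antitone (hN : 0 < N) {i : ℕ} (hi : i < N) :
    meshSlope (1 / (5 * N)) (i + 1) ≤ meshSlope (1 / (5 * N)) i := by
  have hφ := isProfile_sineProfile
  have hmul := mesh_mul hN
  have hN' : (0 : ℝ) < N := by exact_mod_cast hN
  set κ : ℝ := 1 / (5 * N) with hκ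
  have hκ0 : 0 < κ := by positivity
  unfold meshSlope
  push_cast
  refine div_le_div_of_nonneg_right ?_ hκ0.le
  rcases (Nat.succ_le_of_lt hi).lt_or_eq with h | h
  · have h1 : ((i : ℝ) + 1 + 1) * κ ≤ N * κ :=
      mul_le_mul_of_nonneg_right (by exact_mod_cast h) hκ0.le
    have h2 : κ ≤ ((i : ℝ) + 1) * κ := by
      have : 0 ≤ (i : ℝ) * κ := by positivity
      linarith
    have := sineProfile_concave hκ0.le h2 (by linarith)
    rw [show ((i : ℝ) + 1) * κ - κ = i * κ by ring,
      show ((i : ℝ) + 1) * κ + κ = (i + 1 + 1) * κ by ring] at this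
    linarith
  · have h1 : ((i : ℝ) + 1) * κ = 1 / 5 := by
      rw [← hmul, ← h]; push_cast; ring
    have h2 := hφ.saturated ((i + 1) * κ) h1.ge
    rw [h2]
    linarith [hφ.le_one ((i + 1 + 1) * κ), hφ.le_one (i * κ)]

/-- Summation by parts. -/
theorem sum_meshSlope {κ : ℝ} (hκ : 0 < κ) (j n : ℕ) :
    ∑ i ∈ Finset.range n, (meshSlope κ i - meshSlope κ (i + 1)) * reluClamp ((i + 1) * κ) (j * κ)
      = sineProfile ((min n j : ℕ) * κ) - (min n j : ℕ) * κ * meshSlope κ n := by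
  have hslope : ∀ i : ℕ, κ * meshSlope κ i = sineProfile ((i + 1) * κ) - sineProfile (i * κ) :=
    fun i => by rw [meshSlope]; field_simp
  induction n with
  | zero => simp [isProfile_sineProfile.zero]
  | succ n ih =>
    rw [Finset.sum_range_succ, ih, reluClamp_of_nonneg (by positivity) (by positivity)]
    rcases lt_or_ge n j with h | h
    · have h1 : ((n : ℝ) + 1) * κ ≤ j * κ :=
        mul_le_mul_of_nonneg_right (by exact_mod_cast h) hκ.le
      rw [min_eq_right h1, min_eq_left h.le, min_eq_left (Nat.succ_le_of_lt h)]
      push_cast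
      linarith [hslope n]
    · have h1 : (j : ℝ) * κ ≤ (n + 1) * κ :=
        mul_le_mul_of_nonneg_right (by exact_mod_cast h.trans (Nat.le_succ n)) hκ.le
      rw [min_eq_left h1, min_eq_right h, min_eq_right (h.trans (Nat.le_succ n))]
      ring

theorem meshProfile_node (hN : 0 < N) {j : ℕ} (hj : j ≤ N) :
    meshProfile N (j * (1 / (5 * N))) = sineProfile (j * (1 / (5 * N))) := by
  have hN' : (0 : ℝ) < N := by exact_mod_cast hN
  have hκ0 : 0 < 1 / (5 * (N : ℝ)) := by positivity
  have hmul := mesh_mul hN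
  rw [meshProfile, sum_meshSlope hκ0, min_eq_right hj, meshSlope,
    isProfile_sineProfile.saturated (N * _) hmul.ge,
    isProfile_sineProfile.saturated ((N + 1) * _) (by rw [add_mul, hmul]; linarith)]
  simp

/-- By `meshSlope_antitone` the interpolant is a nonnegative combination of clamps. Each clamp is
odd, monotone and star-shaped and is constant from `1/5` on, and such combinations inherit these
properties. The limit value `1` comes from the last node. -/
theorem isProfile_meshProfile (hN : 0 < N) : IsProfile (meshProfile N) := by
  have hw : ∀ i ∈ Finset.range N,
      0 ≤ meshSlope (1 / (5 * N)) i - meshSlope (1 / (5 * N)) (i + 1) := fun i hi =>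
    sub_nonneg.2 (meshSlope_antitone hN (Finset.mem_range.1 hi))
  have hr : ∀ i : ℕ, 0 ≤ ((i : ℝ) + 1) * (1 / (5 * N)) := fun i => by positivity
  refine ⟨fun s => ?_, fun s s' h => ?_, ?_, fun a b ha hab => ?_, fun s hs => ?_⟩
  · simp only [meshProfile, reluClamp_neg, mul_neg, Finset.sum_neg_distrib]
  · exact Finset.sum_le_sum fun i hi =>
      mul_le_mul_of_nonneg_left (reluClamp_mono (hr i) h) (hw i hi)
  · exact continuous_finsetSum _ fun i _ => continuous_const.mul (continuous_reluClamp _)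
  · simp only [meshProfile, Finset.mul_sum]
    refine Finset.sum_le_sum fun i hi => ?_
    have := mul_le_mul_of_nonneg_left (reluClamp_star (hr i) ha hab) (hw i hi)
    linarith
  · have h1 : meshProfile N (1 / 5) = 1 := by
      rw [← mesh_mul hN, meshProfile_node hN le_rfl]
      exact isProfile_sineProfile.saturated _ (mesh_mul hN).ge
    rw [← h1]
    refine Finset.sum_congr rfl fun i hi => ?_
    have h2 : ((i : ℝ) + 1) * (1 / (5 * N)) ≤ 1 / 5 := by
      rw [← mesh_mul hN]
      exact mul_le_mul_of_nonneg_right (by exact_mod_cast Finset.mem_range.1 hi) (by positivity)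
    rw [reluClamp_of_nonneg (hr i) (by linarith), reluClamp_of_nonneg (hr i) (by norm_num),
      min_eq_right (h2.trans hs), min_eq_right h2]

/-- Two monotone functions that agree at the nodes differ by at most the increment over one cell,
here `8κ` with `κ = 1/(5N)`. This first order bound suffices since the number of cells costs no
degrees of freedom. -/
theorem abs_meshProfile_sub_le (hN : 0 < N) (s : ℝ) :
    |meshProfile N s - sineProfile s| ≤ 8 / (5 * N) := by
  have hφ := isProfile_sineProfile
  have hψ := isProfile_meshProfile hN
  have hN' : (0 : ℝ) < N := by exact_mod_cast hN
  have hmul := mesh_mul hN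
  have key : ∀ s, 0 ≤ s → |meshProfile N s - sineProfile s| ≤ 8 / (5 * N) := by
    intro s hs
    rcases le_or_gt (1 / 5) s with h | h
    · rw [hφ.saturated s h, hψ.saturated s h, sub_self, abs_zero]
      positivity
    set κ : ℝ := 1 / (5 * N) with hκ
    have hκ0 : 0 < κ := by positivity
    set j := ⌊s / κ⌋₊ with hj
    have h1 : (j : ℝ) * κ ≤ s := (le_div_iff₀ hκ0).1 (Nat.floor_le (by positivity))
    have h2 : s < ((j + 1 : ℕ) : ℝ) * κ := by
      rw [← div_lt_iff₀ hκ0]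
      exact_mod_cast Nat.lt_floor_add_one (s / κ)
    have hjN : j + 1 ≤ N := by
      have h3 : (j : ℝ) * κ < N * κ := by linarith
      exact_mod_cast lt_of_mul_lt_mul_right h3 hκ0.le
    have e1 := meshProfile_node hN (Nat.le_of_succ_le hjN)
    have e2 := meshProfile_node hN hjN
    rw [← hκ] at e1 e2
    have l1 := hψ.mono h1
    have l2 := hψ.mono h2.le
    have l3 := hφ.mono h1
    have l4 := hφ.mono h2.le
    have l5 := abs_sineProfile_sub_le (((j + 1 : ℕ) : ℝ) * κ) (j * κ)
    rw [show ((j + 1 : ℕ) : ℝ) * κ - j * κ = κ by push_cast; ring, abs_of_pos hκ0] at l5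
    have l6 := (le_abs_self _).trans l5
    rw [show 8 / (5 * (N : ℝ)) = 8 * κ by rw [hκ]; ring]
    exact abs_le.2 ⟨by linarith, by linarith⟩
  rcases le_total 0 s with h | h
  · exact key s h
  · have := key (-s) (by linarith)
    rwa [hφ.odd, hψ.odd, neg_sub_neg, abs_sub_comm] at this

theorem isShallow_meshProfile (N : ℕ) (x₀ : ℝ) :
    IsShallow fun x => 1 / 2 - 1 / 2 * meshProfile N (x - x₀) := by
  have hclamp : ∀ r : ℝ, IsShallow fun x => reluClamp r (x - x₀) := by
    intro r
    have h := ((isShallow_relu_sub (x₀ - r)).add ((isShallow_relu_sub (x₀ + r)).const_mul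
      (-1))).add (isShallow_const (-r))
    convert h using 2 with x
    rw [reluClamp, show x - x₀ + r = x - (x₀ - r) by ring,
      show x - x₀ - r = x - (x₀ + r) by ring]
    ring
  have h := (isShallow_const (1 / 2)).add ((isShallow_sum (Finset.range N) fun i : ℕ =>
    (hclamp ((i + 1) * (1 / (5 * N)))).const_mul
      (meshSlope (1 / (5 * N)) i - meshSlope (1 / (5 * N)) (i + 1))).const_mul (-(1 / 2)))
  convert h using 2 with x
  rw [meshProfile]
  ring

end mesh

/-- Shallow networks approximate the sine profile within the class of profiles. -/
theorem exists_shallow_profile (x₀ : ℝ) {δ : ℝ} (hδ : 0 < δ) :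
    ∃ ψ : ℝ → ℝ, IsProfile ψ ∧ (∀ s, |ψ s - sineProfile s| ≤ δ) ∧
      IsShallow fun x => 1 / 2 - 1 / 2 * ψ (x - x₀) := by
  obtain ⟨n, hn⟩ := exists_nat_gt (8 / (5 * δ))
  have hn0 : (0 : ℝ) < n := lt_trans (by positivity) hn
  have hN : 0 < n := by exact_mod_cast hn0
  refine ⟨meshProfile n, isProfile_meshProfile hN, fun s =>
    (abs_meshProfile_sub_le hN s).trans ?_, isShallow_meshProfile n x₀⟩
  rw [div_lt_iff₀ (by positivity)] at hn
  rw [div_le_iff₀ (by positivity)]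
  linarith

/-! ### Error estimates -/

theorem thresholdLayer_of_le {w β y : ℝ} (h : y ≤ β) : thresholdLayer w (-β) y = y := by
  rw [thresholdLayer, threshold, if_neg (by linarith), mul_zero, add_zero]

theorem thresholdLayer_of_lt {w β y : ℝ} (h : β < y) : thresholdLayer w (-β) y = y + w := by
  rw [thresholdLayer, threshold, if_pos (by linarith), mul_one]

theorem thresholdLayer_mono {w : ℝ} (hw : 0 ≤ w) (β : ℝ) : Monotone (thresholdLayer w (-β)) := by
  intro y z h
  rcases le_or_gt y β with hy | hy
  · rw [thresholdLayer_of_le hy]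
    rcases le_or_gt z β with hz | hz
    · rwa [thresholdLayer_of_le hz]
    · rw [thresholdLayer_of_lt hz]; linarith
  · rw [thresholdLayer_of_lt hy, thresholdLayer_of_lt (hy.trans_le h)]; linarith

/-- The threshold layer that jumps at `β` by `w` and the coefficient `a` are such that
`ξ ↦ ξ + a v(ξ)`, up to the displacement `η`, is the characteristic of the label `ξ` at the
time `t`, for all the labels that the threshold layer attains. -/
structure IsShockFit (x₀ t η : ℝ) (v : ℝ → ℝ) (β w a : ℝ) : Prop where
  jump_nonneg : 0 ≤ w
  coeff_nonneg : 0 ≤ a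
  coeff_lt : a < 1 + w
  label_ge : x₀ - 1 / 5 ≤ β
  label_le : β ≤ x₀
  match_jump : β + a * v β = β + w + a * v (β + w)
  mono : Monotone ((fun x => x + a * v x) ∘ thresholdLayer w (-β))
  le_of_lt : ∀ ξ, ξ ≤ β ∨ β + w ≤ ξ → ∀ x, x < ξ + a * v ξ →
    initialStep x₀ ξ ≤ burgersSolution x₀ t (x - η)
  le_of_gt : ∀ ξ, ξ ≤ β ∨ β + w ≤ ξ → ∀ x, ξ + a * v ξ < x →
    burgersSolution x₀ t (x + η) ≤ initialStep x₀ ξ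

section fit

variable {x₀ t δ : ℝ} {ψ : ℝ → ℝ}

/-- With `a = t`, the layer jumps over the labels that the shock of the approximate profile `ψ` has
absorbed, not the shock of the sine. The composition is then an exact characteristic map for `ψ`,
hence monotone, and lies within `t/2 · δ ≤ δ` of the true one. -/
theorem exists_shockFit_of_le (hψ : IsProfile ψ) (hδ : ∀ s, |ψ s - sineProfile s| ≤ δ)
    (ht : 0 ≤ t) (ht' : t ≤ 2 / 5) :
    ∃ β w a, IsShockFit x₀ t δ (fun x => 1 / 2 - 1 / 2 * ψ (x - x₀)) β w a := by
  obtain ⟨σ, h0, hroot, hpos⟩ := exists_shock_label hψ ht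
  have hσ : σ ≤ 1 / 5 := by
    by_contra h
    push Not at h
    rw [hψ.saturated σ h.le] at hroot
    linarith
  have hG : ∀ ξ, σ ≤ |ξ - x₀| → ξ + t * (1 / 2 - 1 / 2 * ψ (ξ - x₀)) =
      x₀ + t / 2 + relChar ψ t (ξ - x₀) := by
    intro ξ h
    rw [relChar_eq_of_le_abs hψ h0 hroot hpos h]
    ring
  have hout : ∀ ξ, ξ ≤ x₀ - σ ∨ x₀ - σ + 2 * σ ≤ ξ → σ ≤ |ξ - x₀| := by
    rintro ξ (h | h)
    · exact le_abs.2 (Or.inr (by linarith))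
    · exact le_abs.2 (Or.inl (by linarith))
  have hclose : ∀ ξ, ξ ≤ x₀ - σ ∨ x₀ - σ + 2 * σ ≤ ξ →
      |ξ + t * (1 / 2 - 1 / 2 * ψ (ξ - x₀)) - characteristic x₀ t ξ| ≤ δ := by
    intro ξ h
    rw [hG ξ (hout ξ h), characteristic_eq x₀ ht, add_sub_add_left_eq_sub]
    refine (abs_relChar_sub_profile_le ht).trans ?_
    have h1 := hδ (ξ - x₀)
    have h2 := abs_nonneg (ψ (ξ - x₀) - sineProfile (ξ - x₀))
    nlinarith
  refine ⟨x₀ - σ, 2 * σ, t, ⟨by linarith, ht, by linarith, by linarith, by linarith, ?_, ?_, ?_, ?_⟩⟩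
  · show x₀ - σ + t * (1 / 2 - 1 / 2 * ψ (x₀ - σ - x₀)) =
      x₀ - σ + 2 * σ + t * (1 / 2 - 1 / 2 * ψ (x₀ - σ + 2 * σ - x₀))
    rw [show x₀ - σ - x₀ = -σ by ring, show x₀ - σ + 2 * σ - x₀ = σ by ring, hψ.odd]
    linarith
  · have hT := thresholdLayer_mono (show 0 ≤ 2 * σ by linarith) (x₀ - σ)
    have heq : (fun x => x + t * (1 / 2 - 1 / 2 * ψ (x - x₀))) ∘
        thresholdLayer (2 * σ) (-(x₀ - σ)) =
        fun y => x₀ + t / 2 + relChar ψ t (thresholdLayer (2 * σ) (-(x₀ - σ)) y - x₀) := by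
      funext y
      refine hG _ (hout _ ?_)
      rcases le_or_gt y (x₀ - σ) with h | h
      · rw [thresholdLayer_of_le h]; exact Or.inl h
      · rw [thresholdLayer_of_lt h]; exact Or.inr (by linarith)
    rw [heq]
    intro y z h
    exact add_le_add_right (relChar_mono hψ ht (sub_le_sub_right (hT h) x₀)) _
  · intro ξ h x hx
    have := abs_le.1 (hclose ξ h)
    exact le_burgersSolution x₀ ht (by linarith [this.2])
  · intro ξ h x hx
    have := abs_le.1 (hclose ξ h)
    exact burgersSolution_le x₀ ht (by linarith [this.1])

/-- From `t = 2/5` on the shock has absorbed the whole step and only the states `1` and `0` remain,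
so the labels need only lie on the correct side of the shock. With `a = t` the jump would start at
`x₀ - t/2`, which may leave `(0,1)`. Keeping `β = x₀ - 1/5` and taking `a = w = 1/5 + t/2` makes the
composition a translation that sends `β` to the shock `x₀ + t/2`. -/
theorem exists_shockFit_of_ge (hψ : IsProfile ψ) (hδ : 0 ≤ δ) (ht : 2 / 5 ≤ t) :
    ∃ β w a, IsShockFit x₀ t δ (fun x => 1 / 2 - 1 / 2 * ψ (x - x₀)) β w a := by
  have ht0 : 0 ≤ t := by linarith
  have hφ := isProfile_sineProfile
  have hleft : ∀ ξ, ξ ≤ x₀ - 1 / 5 → 1 / 2 - 1 / 2 * ψ (ξ - x₀) = 1 := fun ξ h => by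
    rw [hψ.saturated_neg (by linarith)]; norm_num
  have hright : ∀ ξ, x₀ - 1 / 5 + (1 / 5 + t / 2) ≤ ξ → 1 / 2 - 1 / 2 * ψ (ξ - x₀) = 0 :=
    fun ξ h => by rw [hψ.saturated _ (by linarith)]; norm_num
  have hleft' : ∀ ξ, ξ ≤ x₀ - 1 / 5 → initialStep x₀ ξ = 1 := fun ξ h => by
    rw [initialStep_eq, hφ.saturated_neg (by linarith)]; norm_num
  have hright' : ∀ ξ, x₀ + 1 / 5 ≤ ξ → initialStep x₀ ξ = 0 := fun ξ h => by
    rw [initialStep_eq, hφ.saturated _ (by linarith)]; norm_num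
  have hshock : ∀ s : ℝ, s = 1 / 5 ∨ s = -(1 / 5) → relChar sineProfile t s = 0 := by
    have h1 : relChar sineProfile t (1 / 5) = 0 := by
      rw [relChar_of_nonneg (by norm_num), hφ.saturated _ le_rfl]
      exact max_eq_right (by linarith)
    rintro s (rfl | rfl)
    · exact h1
    · rw [relChar_neg hφ, h1, neg_zero]
  refine ⟨x₀ - 1 / 5, 1 / 5 + t / 2, 1 / 5 + t / 2,
    ⟨by linarith, by linarith, by linarith, le_rfl, by linarith, ?_, ?_, ?_, ?_⟩⟩
  · simp only [hleft _ le_rfl, hright _ le_rfl]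
    ring
  · have heq : (fun x => x + (1 / 5 + t / 2) * (1 / 2 - 1 / 2 * ψ (x - x₀))) ∘
        thresholdLayer (1 / 5 + t / 2) (-(x₀ - 1 / 5)) = fun y => y + (1 / 5 + t / 2) := by
      funext y
      rw [Function.comp_apply]
      rcases le_or_gt y (x₀ - 1 / 5) with h | h
      · rw [thresholdLayer_of_le h, hleft y h, mul_one]
      · rw [thresholdLayer_of_lt h, hright _ (by linarith), mul_zero, add_zero]
    rw [heq]
    intro y z h
    simpa using h
  · rintro ξ (h | h) x hx
    · simp only [hleft ξ h] at hx
      rw [hleft' ξ h, ← hleft' (x₀ - 1 / 5) le_rfl]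
      refine le_burgersSolution x₀ ht0 ?_
      rw [characteristic_eq x₀ ht0, hshock _ (Or.inr (by ring))]
      linarith
    · rw [hright' ξ (by linarith)]
      exact burgersSolution_nonneg _ _ _
  · rintro ξ (h | h) x hx
    · rw [hleft' ξ h]
      exact burgersSolution_le_one _ _ _
    · simp only [hright ξ h] at hx
      rw [hright' ξ (by linarith), ← hright' (x₀ + 1 / 5) le_rfl]
      refine burgersSolution_le x₀ ht0 ?_
      rw [characteristic_eq x₀ ht0, hshock _ (Or.inl (by ring))]
      linarith

end fit

/-! ### Accuracy of the bisected network. -/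

/-- The interval that is left after `n` bisection steps. -/
theorem bisection_spec (g : ℝ → ℝ) (x : ℝ) (n : ℕ) :
    let p := (bisectStep g x)^[n] (0, 1)
    p.2 = p.1 + (1 / 2) ^ n ∧ 0 ≤ p.1 ∧ p.2 ≤ 1 ∧ (p.1 = 0 ∨ g p.1 ≤ x) ∧ (p.2 = 1 ∨ x < g p.2) := by
  induction n with
  | zero => simp
  | succ n ih =>
    rw [Function.iterate_succ_apply']
    obtain ⟨h1, h2, h3, h4, h5⟩ := ih
    set p := (bisectStep g x)^[n] (0, 1)
    have hpow : (0 : ℝ) < (1 / 2) ^ n := by positivity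
    rw [bisectStep]
    by_cases h : 0 < g ((p.1 + p.2) / 2) - x
    · rw [threshold, if_pos h, if_pos rfl]
      refine ⟨?_, h2, ?_, h4, Or.inr (by linarith)⟩
      · rw [pow_succ]; simp only; linarith
      · simp only; linarith
    · rw [threshold, if_neg h, if_neg (by norm_num)]
      refine ⟨?_, ?_, h3, Or.inr (by simp only; linarith), h5⟩
      · rw [pow_succ]; simp only; linarith
      · simp only; linarith

/-- The final bisection interval has length `r` and brackets `x`. If it avoids the jump, the labels
of its ends differ by at most `r`, hence their values of `u₀` by at most `4r`. If it contains the
jump, the labels may be far apart, but by `match_jump` both sides of the jump have the same image,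
which lies within `2r` of `x`, so that either state is allowed up to a shift. -/
theorem shockFit_estimate {x₀ t η δ β w a r x : ℝ} {v : ℝ → ℝ} {n : ℕ}
    (hfit : IsShockFit x₀ t η v β w a) (ht : 0 ≤ t) (hr : r = (1 / 2) ^ n)
    (hrx : r ≤ x₀ - 1 / 5) (hanti : Antitone v) (h0 : ∀ x, 0 ≤ v x)
    (hv : ∀ x, |v x - initialStep x₀ x| ≤ δ) (hx : x < 1) :
    burgersSolution x₀ t (x + (η + 2 * r)) - (4 * r + δ) ≤
        v (thresholdLayer w (-β) (approxInverse ((fun x => x + a * v x) ∘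
          thresholdLayer w (-β)) n x)) ∧
      v (thresholdLayer w (-β) (approxInverse ((fun x => x + a * v x) ∘
          thresholdLayer w (-β)) n x)) ≤
        burgersSolution x₀ t (x - (η + 2 * r)) + (4 * r + δ) := by
  have hr0 : 0 < r := by rw [hr]; positivity
  have hT := thresholdLayer_mono hfit.jump_nonneg β
  have hu := antitone_burgersSolution x₀ ht
  have hu0 := antitone_initialStep x₀
  have hlip : ∀ ξ ζ, ζ - ξ ≤ r → ξ ≤ ζ → initialStep x₀ ξ ≤ initialStep x₀ ζ + 4 * r := by
    intro ξ ζ h h'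
    have h1 := (le_abs_self _).trans (abs_initialStep_sub_le x₀ ξ ζ)
    rw [abs_sub_comm, abs_of_nonneg (sub_nonneg.2 h')] at h1
    linarith
  have hvle : ∀ x, v x ≤ initialStep x₀ x + δ := fun x => by linarith [(abs_le.1 (hv x)).2]
  have hlev : ∀ x, initialStep x₀ x - δ ≤ v x := fun x => by linarith [(abs_le.1 (hv x)).1]
  obtain ⟨h1, h2, h3, h4, h5⟩ := bisection_spec
    ((fun x => x + a * v x) ∘ thresholdLayer w (-β)) x n
  rw [approxInverse]
  set p := (bisectStep ((fun x => x + a * v x) ∘ thresholdLayer w (-β)) x)^[n] (0, 1)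
  rw [← hr] at h1
  -- If the right end was never moved, it is `1`, and its image is at least `1 > x`.
  have hgb : x < thresholdLayer w (-β) p.2 + a * v (thresholdLayer w (-β) p.2) := by
    rcases h5 with h5 | h5
    · have hT1 : p.2 ≤ thresholdLayer w (-β) p.2 := by
        rcases le_or_gt p.2 β with h | h
        · rw [thresholdLayer_of_le h]
        · rw [thresholdLayer_of_lt h]; linarith [hfit.jump_nonneg]
      linarith [mul_nonneg hfit.coeff_nonneg (h0 (thresholdLayer w (-β) p.2))]
    · exact h5
  have hTa : v (thresholdLayer w (-β) ((p.1 + p.2) / 2)) ≤ v (thresholdLayer w (-β) p.1) :=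
    hanti (hT (by linarith))
  have hTb : v (thresholdLayer w (-β) p.2) ≤ v (thresholdLayer w (-β) ((p.1 + p.2) / 2)) :=
    hanti (hT (by linarith))
  have hrange : ∀ y, thresholdLayer w (-β) y ≤ β ∨ β + w ≤ thresholdLayer w (-β) y := by
    intro y
    rcases le_or_gt y β with h | h
    · rw [thresholdLayer_of_le h]; exact Or.inl h
    · rw [thresholdLayer_of_lt h]; exact Or.inr (by linarith)
  have hβ := hfit.label_ge
  by_cases hjump : p.1 ≤ β ∧ β < p.2
  · obtain ⟨ha, hb⟩ := hjump
    rw [thresholdLayer_of_le ha] at hTa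
    rw [thresholdLayer_of_lt hb] at hTb hgb
    -- A left end that was never moved is `0`; then the right end is `r ≤ x₀ - 1/5 ≤ β`, which
    -- contradicts that the jump lies in the interval.
    have hga : p.1 + a * v p.1 ≤ x := by
      rcases h4 with h4 | h4
      · linarith
      · simpa only [Function.comp_apply, thresholdLayer_of_le ha] using h4
    constructor
    · have hβx : β + w + a * v (β + w) < x + 2 * r := by
        rw [← hfit.match_jump]
        linarith [mul_le_mul_of_nonneg_left (hanti ha) hfit.coeff_nonneg]
      have e1 := hfit.le_of_gt (β + w) (Or.inr le_rfl) _ hβx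
      have e2 := hlip (β + w) (p.2 + w) (by linarith) (by linarith)
      rw [show x + (η + 2 * r) = x + 2 * r + η by ring]
      linarith [hlev (p.2 + w)]
    · have hβx : x - 2 * r < β + a * v β := by
        have := mul_le_mul_of_nonneg_left (hanti (show β + w ≤ p.2 + w by linarith))
          hfit.coeff_nonneg
        rw [hfit.match_jump]
        linarith
      have e1 := hfit.le_of_lt β (Or.inl le_rfl) _ hβx
      have e2 := hlip p.1 β (by linarith) ha
      rw [show x - (η + 2 * r) = x - 2 * r - η by ring]
      linarith [hvle p.1]
  · have hdiff : thresholdLayer w (-β) p.2 - thresholdLayer w (-β) p.1 ≤ r := by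
      rcases le_or_gt p.1 β with ha | ha
      · have hb : p.2 ≤ β := not_lt.1 fun h => hjump ⟨ha, h⟩
        rw [thresholdLayer_of_le ha, thresholdLayer_of_le hb]; linarith
      · rw [thresholdLayer_of_lt ha, thresholdLayer_of_lt (by linarith)]; linarith
    have e2 := hlip _ _ hdiff (hT (by linarith))
    constructor
    · have e1 : burgersSolution x₀ t (x + (η + 2 * r)) ≤
          initialStep x₀ (thresholdLayer w (-β) p.1) := by
        rcases h4 with h4 | h4
        · rw [h4, thresholdLayer_of_le (by linarith)]
          refine (burgersSolution_le_one _ _ _).trans (le_of_eq ?_)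
          rw [initialStep_eq, isProfile_sineProfile.saturated_neg (by linarith)]
          norm_num
        · rw [show x + (η + 2 * r) = x + 2 * r + η by ring]
          refine hfit.le_of_gt _ (hrange _) _ (lt_of_le_of_lt h4 ?_)
          linarith
      linarith [hlev (thresholdLayer w (-β) p.2)]
    · have e1 := hfit.le_of_lt _ (hrange p.2) (x - 2 * r) (by linarith)
      rw [show x - (η + 2 * r) = x - 2 * r - η by ring]
      linarith [hvle (thresholdLayer w (-β) p.1)]

/-! ### From the squeeze to the `L²` bound. -/

/-- A function that is squeezed between shifts of a step is close to it in `L²`. -/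
theorem eLpNorm_sub_lt {u f : ℝ → ℝ} {ρ θ ε : ℝ} (hu : Antitone u) (hu0 : ∀ x, 0 ≤ u x)
    (hu1 : ∀ x, u x ≤ 1) (hf0 : ∀ x, 0 ≤ f x) (hf1 : ∀ x, f x ≤ 1) (hρ : 0 ≤ ρ) (hθ : 0 ≤ θ)
    (hε : 0 < ε) (h : 2 * ρ + θ < ε ^ 2)
    (hlow : ∀ x ∈ Ioo (0 : ℝ) 1, u (x + ρ) - θ ≤ f x)
    (hupp : ∀ x ∈ Ioo (0 : ℝ) 1, f x ≤ u (x - ρ) + θ) :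
    eLpNorm (fun x => u x - f x) 2 (volume.restrict (Ioo 0 1)) < ENNReal.ofReal ε := by
  have hi : IntegrableOn (fun x => u (x - ρ) - u (x + ρ) + θ) (Ioo 0 1) := by
    have h1 : IntervalIntegrable (fun x => u (x - ρ)) volume 0 1 :=
      Antitone.intervalIntegrable fun x y h => hu (by linarith)
    have h2 : IntervalIntegrable (fun x => u (x + ρ)) volume 0 1 :=
      Antitone.intervalIntegrable fun x y h => hu (by linarith)
    have h3 := (h1.sub h2).add (intervalIntegrable_const (c := θ))
    rw [intervalIntegrable_iff_integrableOn_Ioo_of_le zero_le_one] at h3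
    exact h3
  have hval : ∫ x in Ioo (0 : ℝ) 1, (u (x - ρ) - u (x + ρ) + θ) ≤ 2 * ρ + θ := by
    rw [← integral_Ioc_eq_integral_Ioo, ← intervalIntegral.integral_of_le zero_le_one,
      intervalIntegral.integral_add _ intervalIntegrable_const]
    · have := integral_shift_sub_le hu hu0 hu1 (a := 0) (b := 1) hρ
      simp only [intervalIntegral.integral_const, sub_zero, one_smul]
      linarith
    · exact IntervalIntegrable.sub (Antitone.intervalIntegrable fun x y h => hu (by linarith))
        (Antitone.intervalIntegrable fun x y h => hu (by linarith))
  have hpt : ∀ x ∈ Ioo (0 : ℝ) 1, |u x - f x| ^ 2 ≤ u (x - ρ) - u (x + ρ) + θ := by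
    intro x hx
    have h1 : u (x + ρ) ≤ u x := hu (by linarith)
    have h2 : u x ≤ u (x - ρ) := hu (by linarith)
    have h3 : |u x - f x| ≤ u (x - ρ) - u (x + ρ) + θ :=
      abs_le.2 ⟨by linarith [hupp x hx], by linarith [hlow x hx]⟩
    have h4 : |u x - f x| ≤ 1 :=
      abs_le.2 ⟨by linarith [hu0 x, hf1 x], by linarith [hu1 x, hf0 x]⟩
    -- The difference is at most `1`, so its square is bounded by the difference itself; this is why
    -- all accuracies are of the order `ε²`.
    nlinarith [abs_nonneg (u x - f x)]
  have hlint : ∫⁻ x in Ioo (0 : ℝ) 1, ‖u x - f x‖ₑ ^ (2 : ℝ) ≤ ENNReal.ofReal (2 * ρ + θ) := by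
    calc ∫⁻ x in Ioo (0 : ℝ) 1, ‖u x - f x‖ₑ ^ (2 : ℝ)
        ≤ ∫⁻ x in Ioo (0 : ℝ) 1, ENNReal.ofReal (u (x - ρ) - u (x + ρ) + θ) := by
          refine setLIntegral_mono' measurableSet_Ioo fun x hx => ?_
          rw [← ofReal_norm, ENNReal.ofReal_rpow_of_nonneg (norm_nonneg _) (by norm_num),
            Real.norm_eq_abs, Real.rpow_two]
          exact ENNReal.ofReal_le_ofReal (hpt x hx)
      _ = ENNReal.ofReal (∫ x in Ioo (0 : ℝ) 1, (u (x - ρ) - u (x + ρ) + θ)) := by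
          refine (ofReal_integral_eq_lintegral_ofReal hi ?_).symm
          filter_upwards [ae_restrict_mem measurableSet_Ioo] with x hx
          exact (sq_nonneg _).trans (hpt x hx)
      _ ≤ _ := ENNReal.ofReal_le_ofReal hval
  rw [eLpNorm_eq_lintegral_rpow_enorm_toReal two_ne_zero ENNReal.ofNat_ne_top,
    ENNReal.toReal_ofNat]
  calc (∫⁻ x in Ioo (0 : ℝ) 1, ‖u x - f x‖ₑ ^ (2 : ℝ)) ^ (1 / (2 : ℝ))
      ≤ ENNReal.ofReal (2 * ρ + θ) ^ (1 / (2 : ℝ)) := by gcongr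
    _ = ENNReal.ofReal (√(2 * ρ + θ)) := by
        rw [ENNReal.ofReal_rpow_of_nonneg (by linarith) (by norm_num), Real.sqrt_eq_rpow]
    _ < ENNReal.ofReal ε := by
        rw [ENNReal.ofReal_lt_ofReal_iff hε, Real.sqrt_lt' hε]
        exact h

/-- Logarithmically many bisection steps reach a given quadratic accuracy. -/
theorem exists_bisection_depth {κ : ℝ} (hκ : 0 < κ) (hκ1 : κ ≤ 1) :
    ∃ C : ℝ, 0 ≤ C ∧ ∀ ε ∈ Ioo (0 : ℝ) 1, ∃ n : ℕ,
      (n : ℝ) ≤ C * (1 + |Real.log ε|) ∧ (1 / 2 : ℝ) ^ n ≤ κ * ε ^ 2 := by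
  have hl2 : 0 < Real.log 2 := Real.log_pos one_lt_two
  have hlκ : Real.log κ ≤ 0 := Real.log_nonpos hκ.le hκ1
  have hA : 0 ≤ -Real.log κ / Real.log 2 := div_nonneg (by linarith) hl2.le
  have hB : 0 ≤ 2 / Real.log 2 := by positivity
  refine ⟨1 + -Real.log κ / Real.log 2 + 2 / Real.log 2, by linarith, fun ε hε => ?_⟩
  have hlε : Real.log ε ≤ 0 := Real.log_nonpos hε.1.le hε.2.le
  have hL : 0 ≤ |Real.log ε| := abs_nonneg _
  have hq : (-Real.log κ + 2 * |Real.log ε|) / Real.log 2 =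
      -Real.log κ / Real.log 2 + 2 / Real.log 2 * |Real.log ε| := by ring
  refine ⟨⌈(-Real.log κ + 2 * |Real.log ε|) / Real.log 2⌉₊, ?_, ?_⟩
  · have h1 := Nat.ceil_lt_add_one
      (show 0 ≤ (-Real.log κ + 2 * |Real.log ε|) / Real.log 2 by rw [hq]; positivity)
    rw [hq] at h1 ⊢
    nlinarith [mul_nonneg hA hL]
  · set n := ⌈(-Real.log κ + 2 * |Real.log ε|) / Real.log 2⌉₊
    have h1 : -Real.log κ + 2 * |Real.log ε| ≤ n * Real.log 2 :=
      (div_le_iff₀ hl2).1 (Nat.le_ceil _)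
    rw [abs_of_nonpos hlε] at h1
    rw [← Real.log_le_log_iff (by positivity) (mul_pos hκ (pow_pos hε.1 2)), Real.log_pow,
      Real.log_mul hκ.ne' (pow_pos hε.1 2).ne', Real.log_pow, one_div, Real.log_inv]
    push_cast
    linarith

end DeepReduction

/-! ### Assembly of the network family. -/

theorem mainTheorem2 (x₀ : ℝ) (hx₀ : x₀ ∈ Set.Ioo (1 / 5 : ℝ) (4 / 5)) :
    DeepReduction.IsBurgersSolution (DeepReduction.initialStep x₀) 3
        (DeepReduction.burgersSolution x₀) ∧
      ∃ C : ℝ, ∀ ε ∈ Set.Ioo (0 : ℝ) 1,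
        ∃ (A : DeepReduction.Architecture 1 1) (Γ : ℝ → A.Weights),
          (A.dof : ℝ) ≤ C * (1 + |Real.log ε|) ∧
          DeepReduction.IsReducedSolution (DeepReduction.burgersSolution x₀) 3 ε A Γ ∧
          DeepReduction.reducedManifold 3 A Γ ⊆ DeepReduction.rdnMats ∧
          ∃ v ∈ DeepReduction.rdn, ∃ n : ℕ, (n : ℝ) ≤ C * (1 + |Real.log ε|) ∧
            ∀ t ∈ Set.Icc (0 : ℝ) 3, DeepReduction.IsSingularMats v n (A.realize (Γ t)) := by
  open DeepReduction in
  refine ⟨isBurgersSolution x₀ hx₀, ?_⟩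
  -- The bound `1/16` serves the error budget; `x₀ - 1/5` keeps the first bisection cell to the left
  -- of the jump.
  have hκ : 0 < min (1 / 16) (x₀ - 1 / 5) := lt_min (by norm_num) (by linarith [hx₀.1])
  obtain ⟨C, hC, hdepth⟩ := exists_bisection_depth hκ ((min_le_left _ _).trans (by norm_num))
  -- This constant bounds both `60 n + 45` and `n`.
  refine ⟨60 * C + 45, fun ε hε => ?_⟩
  obtain ⟨n, hn, hpow⟩ := hdepth ε hε
  have hε2 : 0 < ε ^ 2 := pow_pos hε.1 2
  have hε1 : ε ^ 2 ≤ 1 := pow_le_one₀ hε.1.le hε.2.le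
  have hr1 : (1 / 2 : ℝ) ^ n ≤ ε ^ 2 / 16 :=
    hpow.trans (by nlinarith [min_le_left (1 / 16) (x₀ - 1 / 5)])
  have hr2 : (1 / 2 : ℝ) ^ n ≤ x₀ - 1 / 5 :=
    hpow.trans (by nlinarith [min_le_right (1 / 16) (x₀ - 1 / 5)])
  obtain ⟨ψ, hψ, hψδ, hshallow⟩ := exists_shallow_profile x₀ (show 0 < ε ^ 2 / 8 by positivity)
  have hfit : ∀ t : ℝ, ∃ β w a, t ∈ Icc (0 : ℝ) 3 →
      IsShockFit x₀ t (ε ^ 2 / 8) (fun x => 1 / 2 - 1 / 2 * ψ (x - x₀)) β w a := by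
    intro t
    rcases le_total t (2 / 5) with h | h
    · by_cases ht : 0 ≤ t
      · obtain ⟨β, w, a, h⟩ := exists_shockFit_of_le (x₀ := x₀) hψ hψδ ht h
        exact ⟨β, w, a, fun _ => h⟩
      · exact ⟨0, 0, 0, fun h => absurd h.1 ht⟩
    · obtain ⟨β, w, a, h⟩ := exists_shockFit_of_ge (x₀ := x₀) hψ
        (show 0 ≤ ε ^ 2 / 8 by positivity) h
      exact ⟨β, w, a, fun _ => h⟩
  choose β w a hfit using hfit
  set v : ℝ → ℝ := fun x => 1 / 2 - 1 / 2 * ψ (x - x₀) with hv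
  have hv0 : ∀ x, 0 ≤ v x := fun x => by simp only [hv]; linarith [hψ.le_one (x - x₀)]
  have hv1 : ∀ x, v x ≤ 1 := fun x => by simp only [hv]; linarith [hψ.neg_one_le (x - x₀)]
  have hanti : Antitone v := fun x y h => by
    simp only [hv]; linarith [hψ.mono (sub_le_sub_right h x₀)]
  have hvδ : ∀ x, |v x - initialStep x₀ x| ≤ ε ^ 2 / 8 := fun x => by
    have h := abs_le.1 (hψδ (x - x₀))
    rw [initialStep_eq]
    exact abs_le.2 ⟨by simp only [hv]; linarith [h.2], by simp only [hv]; linarith [h.1]⟩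
  -- `T₂` is taken equal to `T₁₁`: bisection returns the argument of the threshold layer, and the
  -- label is the value of the layer there.
  obtain ⟨A, hA, hΓ⟩ := exists_architecture w (fun t => -β t) a w (fun t => -β t) hshallow n
  choose Γ hΓ using hΓ
  have hsing : ∀ t ∈ Icc (0 : ℝ) 3, IsSingularMats v n (A.realize (Γ t)) := by
    intro t ht
    have hf := hfit t ht
    refine ⟨w t, -β t, a t, w t, -β t, ?_, ?_, ?_, ?_, hΓ t⟩
    · exact ⟨thresholdLayer_mem_rdn _ _, (thresholdLayer_mono hf.jump_nonneg _).monotoneOn _⟩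
    · exact ⟨thresholdLayer_mem_rdn _ _, (thresholdLayer_mono hf.jump_nonneg _).monotoneOn _⟩
    · exact ⟨hshallow.comp_thresholdLayer_mem_rdn _ _ _, hf.mono.monotoneOn _⟩
    -- The jump lies in `[0,1)`, so the value at `0` is at most `a` and the value at `1` is at least
    -- `1 + w > a`.
    · refine ⟨0, ⟨le_rfl, zero_le_one⟩, 1, ⟨zero_le_one, le_rfl⟩, ne_of_lt ?_⟩
      have hβ0 := hf.label_ge
      have hβ1 := hf.label_le
      rw [Function.comp_apply, Function.comp_apply,
        thresholdLayer_of_le (show (0 : ℝ) ≤ β t by linarith [hx₀.1]),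
        thresholdLayer_of_lt (show β t < 1 by linarith [hx₀.2])]
      have h1 := mul_le_mul_of_nonneg_left (hv1 0) hf.coeff_nonneg
      have h2 := mul_nonneg hf.coeff_nonneg (hv0 (1 + w t))
      linarith [hf.coeff_lt]
  have hA' : (A.dof : ℝ) ≤ 60 * n + 45 := by exact_mod_cast hA
  have hL : 0 ≤ |Real.log ε| := abs_nonneg _
  refine ⟨A, Γ, by nlinarith, fun t ht => ?_, ?_, v, hshallow.mem_rdn, n, by nlinarith, hsing⟩
  · simp only [hΓ t, Function.comp_apply]
    have hest := fun x (hx : x ∈ Ioo (0 : ℝ) 1) =>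
      shockFit_estimate (hfit t ht) ht.1 rfl hr2 hanti hv0 hvδ hx.2
    have hr0 : (0 : ℝ) < (1 / 2) ^ n := by positivity
    -- With `r = 2⁻ⁿ ≤ ε²/16`, `ρ = ε²/8 + 2r` and `θ = 4r + ε²/8`, the sum `2ρ + θ` is at most
    -- `7ε²/8`.
    exact eLpNorm_sub_lt (antitone_burgersSolution x₀ ht.1) (burgersSolution_nonneg x₀ t)
      (burgersSolution_le_one x₀ t) (fun x => hv0 _) (fun x => hv1 _) (by linarith)
      (by linarith) hε.1 (by linarith) (fun x hx => (hest x hx).1) (fun x hx => (hest x hx).2)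
  · rintro _ ⟨t, ht, rfl⟩
    exact rdnMats_of_isSingularMats hshallow.mem_rdn (hsing t ht)
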